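/- Let $\mathcal H$ be a separable complex Hilbert space, and let $\mathcal L(B)=\Phi(B)-G^*B-BG$ be a formal generator with the following coefficients. * $\Phi$ is a completely positive map that assigns to each $B\in\mathcal B(\mathcal H)$ a sesquilinear form $\Phi(B)[\varphi,\psi]$ on a common domain $\mathrm{dom}\,\Phi(I)[\cdot]\subseteq\mathcal H$; write $\Phi(B)[\psi]=\Phi(B)[\psi,\psi]$. * $-G$ is the infinitesimal generator of a strongly continuous contraction semigroup $(W_t)_{t\ge 0}$ on $\mathcal H$. Fix $N\ge 1$, put $\mathcal D_N=\mathrm{dom}\,G^N$, and assume: * (domain assumptions) $\mathcal D_N$ is a core of $G$, $W_t\mathcal D_N\subseteq\mathcal D_N\subseteq\mathrm{dom}\,\Phi(I)[\cdot]$ for all $t\ge0$, and $G^*+G=\Phi(I)$ on $\mathcal D_N$ as forms, i.e. $(G\varphi,\psi)+(\varphi,G\psi)=\Phi(I)[\varphi,\psi]$ for all $\varphi,\psi\in\mathcal D_N$ (that is, $G=\frac12\Phi(I)+iH$ with a symmetric Hamiltonian form $H$); * (continuity assumptions) there is a positive self-adjoint operator $\Lambda$ with $\Lambda\ge\Phi(I)\ge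 I$ in the sense of forms, such that $\Lambda^{-1/2}\Phi(\cdot)\Lambda^{-1/2}$ is a bounded normal map of $\mathcal B(\mathcal H)$, and for every $\psi\in\mathcal D_N$ the function $t\mapsto\Lambda^{1/2}W_t\psi$ is well defined and norm-continuous on $[0,\infty)$. The minimal quantum dynamical semigroup $(P^{\min}_t)_{t\ge0}$ is the family of linear maps of $\mathcal B(\mathcal H)$ such that, for every $B\ge0$, $P^{\min}_t(B)$ is the least upper bound of the bounded operators $P^{(n)}_t(B)$ given by $$P^{(0)}_t(B)=W_t^*BW_t,\qquad (\psi,P^{(n+1)}_t(B)\psi)=(W_t\psi,BW_t\psi)+\int_0^t\Phi\bigl(P^{(n)}_s(B)\bigr)[W_{t-s}\psi]\,ds\quad(\psi\in\mathcal D_N).$$ **Theorem.** Suppose that there are a bounded operator $X\ge0$, $X\ne0$, with $\|X\|\le1$ and a number $\varepsilon>0$ such that $$\mathcal L_*(X)[\psi]:=\Phi(X)[\psi]-(G\psi,X\psi)-(\psi,XG\psi)\ \ge\ \varepsilon\,(\psi,X\psi)\qquad\text{for all }\psi\in\mathcal D_N .$$ Then the minimal quantum dynamical semigroup exists and does not preserve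 the unit operator: $P^{\min}_t(I)\ne I$ for some $t>0$. -/

import Mathlib

open Set Filter Topology MeasureTheory
open scoped InnerProductSpace ComplexOrder

namespace MarkovMaster

variable {H : Type*} [NormedAddCommGroup H] [InnerProductSpace ℂ H] [CompleteSpace H]

/-- The domain of `G ^ n` for an unbounded operator `G`. -/
def powDomain (G : H →ₗ.[ℂ] H) : ℕ → Submodule ℂ H
  | 0 => ⊤
  | n + 1 => ((powDomain G n).comap G.toFun).map G.domain.subtype

/-- The ultraweak (σ-weak) topology on the bounded operators: it is generated by the functionals
`X ↦ ∑ n, ⟪x n, X (y n)⟫` with `∑ n, ‖x n‖ ^ 2 < ∞` and `∑ n, ‖y n‖ ^ 2 < ∞`. -/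
@[reducible] noncomputable def ultraweakTopology : TopologicalSpace (H →L[ℂ] H) :=
  ⨅ p : {p : (ℕ → H) × (ℕ → H) //
      Summable (fun n => ‖p.1 n‖ ^ 2) ∧ Summable (fun n => ‖p.2 n‖ ^ 2)},
    TopologicalSpace.induced (fun X : H →L[ℂ] H => ∑' n, ⟪p.1.1 n, X (p.1.2 n)⟫_ℂ) inferInstance

/-- A bounded linear map on the bounded operators is normal if it is ultraweakly continuous. -/
def IsNormalMap (A : (H →L[ℂ] H) →L[ℂ] (H →L[ℂ] H)) : Prop :=
  Continuous[ultraweakTopology, ultraweakTopology] A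

/-- A positive self-adjoint (densely defined) operator. -/
def IsPosSelfAdjoint (T : H →ₗ.[ℂ] H) : Prop :=
  IsSelfAdjoint T ∧ ∀ ψ : T.domain, 0 ≤ ⟪(ψ : H), T ψ⟫_ℂ

/-- `S` is the positive self-adjoint square root of `T`: `T = S ^ 2`, including domains. -/
def IsPosSqrt (S T : H →ₗ.[ℂ] H) : Prop :=
  IsPosSelfAdjoint S ∧
    ∀ ψ η : H, (ψ, η) ∈ T.graph ↔ ∃ ξ : H, (ψ, ξ) ∈ S.graph ∧ (ξ, η) ∈ S.graph

/-- A completely positive map `X ↦ Φ(X)` on the bounded operators whose values are, in general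
unbounded, sesquilinear forms with the common domain `formDomain`, the domain of the quadratic
form `Φ(I)[·]`. -/
structure CPFormMap (H : Type*) [NormedAddCommGroup H] [InnerProductSpace ℂ H]
    [CompleteSpace H] where
  formDomain : Submodule ℂ H
  form : (H →L[ℂ] H) →ₗ[ℂ] (formDomain →ₗ⋆[ℂ] formDomain →ₗ[ℂ] ℂ)
  completelyPositive : ∀ (n : ℕ) (X : Fin n → (H →L[ℂ] H)) (ψ : Fin n → formDomain),
    0 ≤ ∑ i, ∑ j, form (star (X i) * X j) (ψ i) (ψ j)

open Classical in
/-- The value `Φ(X)[φ, ψ]` for vectors of the form domain (and `0` for other vectors). -/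
noncomputable def CPFormMap.val (Φ : CPFormMap H) (X : H →L[ℂ] H) (φ ψ : H) : ℂ :=
  if h : φ ∈ Φ.formDomain ∧ ψ ∈ Φ.formDomain then Φ.form X ⟨φ, h.1⟩ ⟨ψ, h.2⟩ else 0

/-- A strongly continuous semigroup `W t`, `t ≥ 0`, of contractions. Values at negative times
are irrelevant. -/
structure ContractionSemigroup (H : Type*) [NormedAddCommGroup H] [InnerProductSpace ℂ H]
    [CompleteSpace H] where
  op : ℝ → (H →L[ℂ] H)
  op_zero : op 0 = 1
  op_add : ∀ s t : ℝ, 0 ≤ s → 0 ≤ t → op (s + t) = op s * op t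
  norm_op_le : ∀ t : ℝ, 0 ≤ t → ‖op t‖ ≤ 1
  continuousOn_op : ∀ ψ : H, ContinuousOn (fun t => op t ψ) (Ici 0)

/-- `W t = exp (-t G)`: the operator `-G`, with its exact domain, is the infinitesimal generator
of `W`. -/
def ContractionSemigroup.IsGeneratedBy (W : ContractionSemigroup H) (G : H →ₗ.[ℂ] H) : Prop :=
  ∀ ψ η : H, (ψ, η) ∈ G.graph ↔
    Tendsto (fun t : ℝ => t⁻¹ • (ψ - W.op t ψ)) (𝓝[>] 0) (𝓝 η)

/-- The coefficients of a formal generator `L(B) = Φ(B) - G* B - B G` with constant coefficients.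
The relation `G = Φ(I) / 2 + i H` with a symmetric Hamiltonian `H` is part of the domain
assumptions: it is the identity `G* + G = Φ(I)`, the symmetric form of the Hamiltonian
being `(G - G*) / 2i`. -/
structure FormalGenerator (H : Type*) [NormedAddCommGroup H] [InnerProductSpace ℂ H]
    [CompleteSpace H] where
  Φ : CPFormMap H
  G : H →ₗ.[ℂ] H

/-- The quadratic form
`L(B)[ψ] = Φ(B)[ψ] - ⟪G ψ, B ψ⟫ - ⟪ψ, B G ψ⟫` of the formal generator. -/
noncomputable def FormalGenerator.quadForm (L : FormalGenerator H) (B : H →L[ℂ] H)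
    (ψ : L.G.domain) : ℂ :=
  L.Φ.val B ψ ψ - ⟪L.G ψ, B ψ⟫_ℂ - ⟪(ψ : H), B (L.G ψ)⟫_ℂ

/-- The domain assumptions, with `D_N = dom (G ^ N)`: `D_N` is a core of `G`, invariant under the
semigroup, contained in the domain of the form `Φ(I)[·]`, and `G* + G = Φ(I)` on `D_N`. -/
structure FormalGenerator.DomainAssumptions (L : FormalGenerator H) (W : ContractionSemigroup H)
    (N : ℕ) : Prop where
  hasCore : L.G.HasCore (powDomain L.G N)
  invariant : ∀ t : ℝ, 0 ≤ t → ∀ ψ ∈ powDomain L.G N, W.op t ψ ∈ powDomain L.G N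
  le_formDomain : powDomain L.G N ≤ L.Φ.formDomain
  adjoint_add : ∀ φ ψ : L.G.domain, (φ : H) ∈ powDomain L.G N → (ψ : H) ∈ powDomain L.G N →
    ⟪L.G φ, (ψ : H)⟫_ℂ + ⟪(φ : H), L.G ψ⟫_ℂ = L.Φ.val 1 φ ψ

/-- The continuity conditions: there is a positive self-adjoint `Λ ≥ Φ(I) ≥ I` (in the sense of
forms; `S` is `Λ ^ (1/2)`) such that `A = Λ ^ (-1/2) Φ(·) Λ ^ (-1/2)` is a bounded normal map,
and `t ↦ Λ ^ (1/2) W t ψ` is defined and norm-continuous (in particular locally square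
integrable) on `[0, ∞)` for every `ψ` in `D_N`. -/
def FormalGenerator.ContinuityConditions (L : FormalGenerator H) (W : ContractionSemigroup H)
    (N : ℕ) : Prop :=
  ∃ Λ S : H →ₗ.[ℂ] H, IsPosSelfAdjoint Λ ∧ IsPosSqrt S Λ ∧
    (∀ ψ ∈ L.Φ.formDomain, ‖ψ‖ ^ 2 ≤ (L.Φ.val 1 ψ ψ).re) ∧
    S.domain ≤ L.Φ.formDomain ∧
    (∀ ψ : S.domain, (L.Φ.val 1 ψ ψ).re ≤ ‖S ψ‖ ^ 2) ∧
    (∃ A : (H →L[ℂ] H) →L[ℂ] (H →L[ℂ] H), IsNormalMap A ∧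
      ∀ (X : H →L[ℂ] H) (φ ψ : S.domain), L.Φ.val X φ ψ = ⟪S φ, A X (S ψ)⟫_ℂ) ∧
    ∀ ψ ∈ powDomain L.G N, ∃ f : ℝ → H, ContinuousOn f (Ici 0) ∧
      ∀ t : ℝ, 0 ≤ t → (W.op t ψ, f t) ∈ S.graph

/-- The iterates `P⁽ⁿ⁾` of the integral form of the master equation: with
`V_t(B) = (W t)* B (W t)`,
`P⁽⁰⁾_t(B) = V_t(B)` and `P⁽ⁿ⁺¹⁾_t(B) = V_t(B) + ∫₀ᵗ V_{t-s}(Φ(P⁽ⁿ⁾_s(B))) ds`,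
as bounded operators determined by their quadratic forms on `D_N`. -/
def FormalGenerator.IsIteration (L : FormalGenerator H) (W : ContractionSemigroup H) (N : ℕ)
    (P : ℕ → ℝ → (H →L[ℂ] H) → (H →L[ℂ] H)) : Prop :=
  (∀ t : ℝ, 0 ≤ t → ∀ B, P 0 t B = star (W.op t) * B * W.op t) ∧
  ∀ (n : ℕ) (t : ℝ), 0 ≤ t → ∀ B, ∀ ψ ∈ powDomain L.G N,
    IntervalIntegrable
      (fun s => L.Φ.val (P n s B) (W.op (t - s) ψ) (W.op (t - s) ψ)) volume 0 t ∧
    ⟪ψ, P (n + 1) t B ψ⟫_ℂ = ⟪W.op t ψ, B (W.op t ψ)⟫_ℂ +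
      ∫ s in (0 : ℝ)..t, L.Φ.val (P n s B) (W.op (t - s) ψ) (W.op (t - s) ψ)

/-- `T` is the minimal quantum dynamical semigroup (on times `t ≥ 0`): each `T t` is the linear
map whose value at a positive `B` is the least upper bound of the iterates `P⁽ⁿ⁾_t(B)`. -/
def FormalGenerator.IsMinimalQDS (L : FormalGenerator H) (W : ContractionSemigroup H) (N : ℕ)
    (T : ℝ → (H →L[ℂ] H) →ₗ[ℂ] (H →L[ℂ] H)) : Prop :=
  ∃ P : ℕ → ℝ → (H →L[ℂ] H) → (H →L[ℂ] H), L.IsIteration W N P ∧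
    ∀ t : ℝ, 0 ≤ t → ∀ B : H →L[ℂ] H, 0 ≤ B → IsLUB (range fun n => P n t B) (T t B)

end MarkovMaster

/-! ### Bounded operators: the form order, weak limits, representation of forms. -/

namespace MarkovMaster

section Operators

variable {H : Type*} [NormedAddCommGroup H] [InnerProductSpace ℂ H]

/-! The inequality `L(X) ≥ εX` makes `e^{εt} X` a subsolution of the integral master equation
(`exp_mul_inner_le`), while `G* + G = Φ(I)` makes the constant `I` an exact solution
(`integral_val_one`). Hence any mass that `e^{εt} X` has beyond the iterates at `X` is controlled by
the defect of the unit: for `0 ≤ t ≤ T`, `e^{εt} X - P⁽ⁿ⁾_t(X) ≤ e^{εT} (I - P⁽ⁿ⁾_t(I))`. This is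
`exp_smul_sub_le`, proved by induction on `n` from positivity of `Φ`. If the minimal semigroup
preserved the unit, the right side would tend weakly to `0`; since `‖P⁽ⁿ⁾_t(X)‖ ≤ ‖X‖ ≤ 1`, the
forms of `e^{εt} X` would stay bounded by `‖ψ‖²` for all `t`, which is impossible for `X ≥ 0`, `X ≠
0`.

Existence rests on two facts. Normality of `Λ^{-1/2} Φ(·) Λ^{-1/2}` and norm continuity of `Λ^{1/2}
W_t ψ` make the integrands continuous (`continuous_val`). Cauchy–Schwarz for `Φ` (`norm_val_le`) and
the energy balance keep each iterate at norm at most `‖B‖`. The iterates at `B ≥ 0` then increase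
and are bounded, so they converge weakly to their least upper bound; linearity passes to the limit.
-/

theorem nonneg_iff_inner {A : H →L[ℂ] H} : 0 ≤ A ↔ ∀ ψ : H, 0 ≤ ⟪ψ, A ψ⟫_ℂ := by
  rw [ContinuousLinearMap.nonneg_iff_isPositive]
  refine ⟨fun h ψ => h.inner_nonneg_right ψ, fun h => ?_⟩
  rw [ContinuousLinearMap.isPositive_iff_complex]
  intro ψ
  have h1 := h ψ
  rw [← inner_conj_symm] at h1
  have h2 : 0 ≤ ⟪A ψ, ψ⟫_ℂ := by
    rwa [← Complex.star_def, star_nonneg_iff] at h1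
  rw [Complex.nonneg_iff] at h2
  exact ⟨Complex.ext rfl (by simpa using h2.2), h2.1⟩

theorem le_iff_inner {A B : H →L[ℂ] H} : A ≤ B ↔ ∀ ψ : H, ⟪ψ, A ψ⟫_ℂ ≤ ⟪ψ, B ψ⟫_ℂ := by
  rw [ContinuousLinearMap.le_def, ← ContinuousLinearMap.nonneg_iff_isPositive, nonneg_iff_inner]
  simp

/-- The polarization identity for the form `⟪φ, A ψ⟫`. -/
theorem inner_polarization (A : H →L[ℂ] H) (φ ψ : H) :
    ⟪φ, A ψ⟫_ℂ = (⟪φ + ψ, A (φ + ψ)⟫_ℂ - ⟪φ - ψ, A (φ - ψ)⟫_ℂ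
      - Complex.I * ⟪φ + Complex.I • ψ, A (φ + Complex.I • ψ)⟫_ℂ
      + Complex.I * ⟪φ - Complex.I • ψ, A (φ - Complex.I • ψ)⟫_ℂ) / 4 := by
  simp only [map_add, map_sub, map_smul, inner_add_left, inner_add_right, inner_sub_left,
    inner_sub_right, inner_smul_left, inner_smul_right, Complex.conj_I]
  linear_combination (1 / 2) * (⟪φ, A ψ⟫_ℂ - ⟪ψ, A φ⟫_ℂ) * Complex.I_sq

theorem norm_inner_operator_le (A : H →L[ℂ] H) (φ ψ : H) {C : ℝ} (hA : ‖A‖ ≤ C) :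
    ‖⟪φ, A ψ⟫_ℂ‖ ≤ C * ‖φ‖ * ‖ψ‖ :=
  calc ‖⟪φ, A ψ⟫_ℂ‖ ≤ ‖φ‖ * (‖A‖ * ‖ψ‖) :=
        (norm_inner_le_norm _ _).trans (by gcongr; exact A.le_opNorm _)
    _ ≤ ‖φ‖ * (C * ‖ψ‖) := by gcongr
    _ = C * ‖φ‖ * ‖ψ‖ := by ring

/-- A weakly continuous bounded family has a jointly continuous form. -/
theorem continuous_inner_operator {ι : Type*} [TopologicalSpace ι] {K : ι → H →L[ℂ] H} {C : ℝ}
    (hK : ∀ s, ‖K s‖ ≤ C) (hc : ∀ φ ψ, Continuous fun s => ⟪φ, K s ψ⟫_ℂ) :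
    Continuous fun p : ι × H × H => ⟪p.2.1, K p.1 p.2.2⟫_ℂ := by
  rw [continuous_iff_continuousAt]
  rintro ⟨s₀, x₀, y₀⟩
  -- The uniform bound `C` absorbs the variation of the two vectors; only this term needs weak
  -- continuity.
  have h0 : Tendsto (fun p : ι × H × H => ⟪x₀, K p.1 y₀⟫_ℂ) (𝓝 (s₀, x₀, y₀))
      (𝓝 ⟪x₀, K s₀ y₀⟫_ℂ) := ((hc x₀ y₀).comp continuous_fst).tendsto _
  have h1 : Tendsto (fun p : ι × H × H => ⟪p.2.1 - x₀, K p.1 p.2.2⟫_ℂ) (𝓝 (s₀, x₀, y₀))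
      (𝓝 0) := by
    refine squeeze_zero_norm (fun p => norm_inner_operator_le _ _ _ (hK p.1)) ?_
    have : Continuous fun p : ι × H × H => C * ‖p.2.1 - x₀‖ * ‖p.2.2‖ := by fun_prop
    simpa using this.tendsto (s₀, x₀, y₀)
  have h2 : Tendsto (fun p : ι × H × H => ⟪x₀, K p.1 (p.2.2 - y₀)⟫_ℂ) (𝓝 (s₀, x₀, y₀))
      (𝓝 0) := by
    refine squeeze_zero_norm (fun p => norm_inner_operator_le _ _ _ (hK p.1)) ?_
    have : Continuous fun p : ι × H × H => C * ‖x₀‖ * ‖p.2.2 - y₀‖ := by fun_prop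
    simpa using this.tendsto (s₀, x₀, y₀)
  have h3 := (h1.add h2).add h0
  simp only [zero_add] at h3
  refine h3.congr fun p => ?_
  simp only [map_sub, inner_sub_left, inner_sub_right]
  ring

/-- For bounded families weak continuity can be checked on a dense subspace. -/
theorem continuous_inner_of_dense {ι : Type*} [TopologicalSpace ι] {D : Submodule ℂ H}
    (hD : Dense (D : Set H)) {K : ι → H →L[ℂ] H} {C : ℝ} (hK : ∀ s, ‖K s‖ ≤ C)
    (hc : ∀ φ ∈ D, ∀ ψ ∈ D, Continuous fun s => ⟪φ, K s ψ⟫_ℂ) (φ ψ : H) :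
    Continuous fun s => ⟪φ, K s ψ⟫_ℂ := by
  rcases isEmpty_or_nonempty ι with hι | ⟨⟨s₁⟩⟩
  · exact continuous_of_const fun s => (IsEmpty.false s).elim
  have hC : 0 ≤ C := (norm_nonneg _).trans (hK s₁)
  rw [continuous_iff_continuousAt]
  intro s₀
  rw [ContinuousAt, Metric.tendsto_nhds]
  intro ε hε
  -- The tolerance for `ψ'` depends on `‖φ'‖`, so `φ'` is chosen first. The errors `ε/8 + ε/8` are
  -- uniform in `s`.
  have h1 : ∃ φ' ∈ (D : Set H), ‖φ - φ'‖ * (C * ‖ψ‖) < ε / 8 ∧ ‖φ - φ'‖ < 1 := by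
    have hcont : Continuous fun φ' : H => ‖φ - φ'‖ * (C * ‖ψ‖) := by fun_prop
    have hcont' : Continuous fun φ' : H => ‖φ - φ'‖ := by fun_prop
    have ho : IsOpen {φ' : H | ‖φ - φ'‖ * (C * ‖ψ‖) < ε / 8 ∧ ‖φ - φ'‖ < 1} :=
      (isOpen_lt hcont continuous_const).inter (isOpen_lt hcont' continuous_const)
    obtain ⟨x, hx, hxD⟩ := hD.inter_open_nonempty _ ho ⟨φ, by simp [hε]⟩
    exact ⟨x, hxD, hx⟩
  obtain ⟨φ', hφ', hφ1, -⟩ := h1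
  have h2 : ∃ ψ' ∈ (D : Set H), C * ‖φ'‖ * ‖ψ - ψ'‖ < ε / 8 := by
    have hcont : Continuous fun ψ' : H => C * ‖φ'‖ * ‖ψ - ψ'‖ := by fun_prop
    have ho : IsOpen {ψ' : H | C * ‖φ'‖ * ‖ψ - ψ'‖ < ε / 8} := isOpen_lt hcont continuous_const
    obtain ⟨x, hx, hxD⟩ := hD.inter_open_nonempty _ ho ⟨ψ, by simp [hε]⟩
    exact ⟨x, hxD, hx⟩
  obtain ⟨ψ', hψ', hψ1⟩ := h2
  have key : ∀ s, ‖⟪φ, K s ψ⟫_ℂ - ⟪φ', K s ψ'⟫_ℂ‖ < ε / 4 := by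
    intro s
    have : ⟪φ, K s ψ⟫_ℂ - ⟪φ', K s ψ'⟫_ℂ = ⟪φ - φ', K s ψ⟫_ℂ + ⟪φ', K s (ψ - ψ')⟫_ℂ := by
      simp only [map_sub, inner_sub_left, inner_sub_right]
      ring
    rw [this]
    have e1 := norm_inner_operator_le (K s) (φ - φ') ψ (hK s)
    have e2 := norm_inner_operator_le (K s) φ' (ψ - ψ') (hK s)
    have e3 := norm_add_le ⟪φ - φ', K s ψ⟫_ℂ ⟪φ', K s (ψ - ψ')⟫_ℂ
    linarith [mul_comm (C * ‖ψ‖) ‖φ - φ'‖, mul_right_comm C ‖φ - φ'‖ ‖ψ‖]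
  have hcs := (hc φ' hφ' ψ' hψ').tendsto s₀
  rw [Metric.tendsto_nhds] at hcs
  filter_upwards [hcs (ε / 4) (by positivity)] with s hs
  rw [dist_eq_norm] at hs ⊢
  have : ⟪φ, K s ψ⟫_ℂ - ⟪φ, K s₀ ψ⟫_ℂ = (⟪φ, K s ψ⟫_ℂ - ⟪φ', K s ψ'⟫_ℂ)
      + (⟪φ', K s ψ'⟫_ℂ - ⟪φ', K s₀ ψ'⟫_ℂ) - (⟪φ, K s₀ ψ⟫_ℂ - ⟪φ', K s₀ ψ'⟫_ℂ) := by ring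
  rw [this]
  have e1 := norm_sub_le ((⟪φ, K s ψ⟫_ℂ - ⟪φ', K s ψ'⟫_ℂ)
      + (⟪φ', K s ψ'⟫_ℂ - ⟪φ', K s₀ ψ'⟫_ℂ)) (⟪φ, K s₀ ψ⟫_ℂ - ⟪φ', K s₀ ψ'⟫_ℂ)
  have e2 := norm_add_le (⟪φ, K s ψ⟫_ℂ - ⟪φ', K s ψ'⟫_ℂ) (⟪φ', K s ψ'⟫_ℂ - ⟪φ', K s₀ ψ'⟫_ℂ)
  linarith [key s, key s₀]

theorem nonneg_of_dense {D : Submodule ℂ H} (hD : Dense (D : Set H)) {A : H →L[ℂ] H}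
    (h : ∀ ψ ∈ D, 0 ≤ ⟪ψ, A ψ⟫_ℂ) : 0 ≤ A :=
  nonneg_iff_inner.2 fun ψ => hD.induction (P := fun ψ : H => 0 ≤ ⟪ψ, A ψ⟫_ℂ) h
    (isClosed_le (by fun_prop) (by fun_prop)) ψ

theorem le_of_dense {D : Submodule ℂ H} (hD : Dense (D : Set H)) {A B : H →L[ℂ] H}
    (h : ∀ ψ ∈ D, ⟪ψ, A ψ⟫_ℂ ≤ ⟪ψ, B ψ⟫_ℂ) : A ≤ B := by
  rw [ContinuousLinearMap.le_def, ← ContinuousLinearMap.nonneg_iff_isPositive]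
  refine nonneg_of_dense hD fun ψ hψ => ?_
  simpa using h ψ hψ

theorem eq_of_dense {D : Submodule ℂ H} (hD : Dense (D : Set H)) {A B : H →L[ℂ] H}
    (h : ∀ ψ ∈ D, ⟪ψ, A ψ⟫_ℂ = ⟪ψ, B ψ⟫_ℂ) : A = B :=
  le_antisymm (le_of_dense hD fun ψ hψ => (h ψ hψ).le) (le_of_dense hD fun ψ hψ => (h ψ hψ).ge)

/-- The operator order is tested on quadratic forms, and inequalities between these survive weak
limits. -/
theorem isLUB_of_weak_limit {P : ℕ → H →L[ℂ] H} (hmono : Monotone P) {T : H →L[ℂ] H}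
    (hT : ∀ φ ψ, Tendsto (fun n => ⟪φ, P n ψ⟫_ℂ) atTop (𝓝 ⟪φ, T ψ⟫_ℂ)) :
    IsLUB (range P) T := by
  constructor
  · rintro _ ⟨n, rfl⟩
    refine le_iff_inner.2 fun ψ => ?_
    exact ge_of_tendsto (hT ψ ψ) (eventually_atTop.2 ⟨n, fun m hm => le_iff_inner.1 (hmono hm) ψ⟩)
  · intro U hU
    refine le_iff_inner.2 fun ψ => ?_
    exact le_of_tendsto (hT ψ ψ) (.of_forall fun n => le_iff_inner.1 (hU ⟨n, rfl⟩) ψ)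

/-- Normal maps preserve weak continuity of bounded families. -/
theorem IsNormalMap.continuous_inner {A : (H →L[ℂ] H) →L[ℂ] (H →L[ℂ] H)} (hA : IsNormalMap A)
    {ι : Type*} [TopologicalSpace ι] {K : ι → H →L[ℂ] H} {C : ℝ} (hK : ∀ s, ‖K s‖ ≤ C)
    (hc : ∀ φ ψ, Continuous fun s => ⟪φ, K s ψ⟫_ℂ) (φ ψ : H) :
    Continuous fun s => ⟪φ, A (K s) ψ⟫_ℂ := by
  -- On bounded families weak continuity implies ultraweak continuity, by the Weierstrass M-test.
  have hKu : Continuous[_, ultraweakTopology] K := by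
    refine continuous_iInf_rng.2 fun p => continuous_induced_rng.2 ?_
    rcases isEmpty_or_nonempty ι with hι | ⟨⟨s₁⟩⟩
    · exact continuous_of_const fun s => (IsEmpty.false s).elim
    have hC : 0 ≤ C := (norm_nonneg _).trans (hK s₁)
    refine continuous_tsum (u := fun n => C * (‖p.1.1 n‖ ^ 2 + ‖p.1.2 n‖ ^ 2))
      (fun n => hc _ _) ((p.2.1.add p.2.2).mul_left C) fun n s => ?_
    refine (norm_inner_operator_le _ _ _ (hK s)).trans ?_
    rw [mul_assoc]
    gcongr
    nlinarith [sq_nonneg (‖p.1.1 n‖ - ‖p.1.2 n‖), sq_nonneg (‖p.1.1 n‖ + ‖p.1.2 n‖)]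
  have h1 : Continuous[_, ultraweakTopology] fun s => A (K s) :=
    @Continuous.comp _ _ _ _ ultraweakTopology ultraweakTopology _ _ hA hKu
  -- Sequences supported at one index turn an ultraweak functional into a single matrix element.
  have hs : ∀ x : H, Summable fun n : ℕ => ‖(Pi.single 0 x : ℕ → H) n‖ ^ 2 := fun x =>
    summable_of_ne_finset_zero (s := {0}) fun n hn => by
      rw [Finset.mem_singleton] at hn
      simp [hn]
  have h2 := continuous_induced_rng.1
    (continuous_iInf_rng.1 h1 ⟨(Pi.single 0 φ, Pi.single 0 ψ), hs φ, hs ψ⟩)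
  refine h2.congr fun s => ?_
  simp only [Function.comp]
  rw [tsum_eq_single 0 fun n hn => by simp [hn]]
  simp

variable [CompleteSpace H]

/-- A bounded sesquilinear form on a dense subspace is represented by a bounded operator. -/
theorem exists_operator_of_dense {D : Submodule ℂ H} (hD : Dense (D : Set H))
    (b : D →ₗ⋆[ℂ] D →ₗ[ℂ] ℂ) {C : ℝ} (hC : 0 ≤ C)
    (hb : ∀ φ ψ : D, ‖b φ ψ‖ ≤ C * ‖φ‖ * ‖ψ‖) :
    ∃ T : H →L[ℂ] H, ‖T‖ ≤ C ∧ ∀ φ ψ : D, ⟪(φ : H), T ψ⟫_ℂ = b φ ψ := by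
  have hdr : DenseRange D.subtypeL := by
    simpa [DenseRange] using hD
  have hui : IsUniformInducing D.subtypeL := isUniformInducing_val _
  -- The form is extended one variable at a time, with a flip after each extension.
  set b₁ : D →L⋆[ℂ] D →L[ℂ] ℂ := b.mkContinuous₂ C hb
  set b₂ : D →L[ℂ] H →L⋆[ℂ] ℂ := (b₁.extend D.subtypeL).flip
  set b₃ : H →L⋆[ℂ] H →L[ℂ] ℂ := (b₂.extend D.subtypeL).flip
  have hb₃ : ∀ φ ψ : D, b₃ φ ψ = b φ ψ := by
    intro φ ψ
    have h1 : b₃ φ ψ = b₂ ψ φ := by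
      change (b₂.extend D.subtypeL) (D.subtypeL ψ) φ = _
      rw [ContinuousLinearMap.extend_eq _ hdr hui]
    have h2 : b₂ ψ φ = b₁ φ ψ := by
      change (b₁.extend D.subtypeL) (D.subtypeL φ) ψ = _
      rw [ContinuousLinearMap.extend_eq _ hdr hui]
    rw [h1, h2]
    rfl
  -- The representing operator of `b₃` acts in the left slot of the inner product, hence the
  -- adjoint.
  set T : H →L[ℂ] H := star (InnerProductSpace.continuousLinearMapOfBilin b₃)
  have hT : ∀ φ ψ : H, ⟪φ, T ψ⟫_ℂ = b₃ φ ψ := by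
    intro φ ψ
    rw [← InnerProductSpace.continuousLinearMapOfBilin_apply]
    exact ContinuousLinearMap.adjoint_inner_right _ _ _
  refine ⟨T, ?_, fun φ ψ => by rw [hT, hb₃]⟩
  have hbd : ∀ ψ : D, ‖T ψ‖ ≤ C * ‖(ψ : H)‖ := by
    intro ψ
    -- The test vector is `T ψ` itself; it need not lie in `D`, so the bound is first extended by
    -- density.
    have h : ‖⟪T ψ, T ψ⟫_ℂ‖ ≤ C * ‖(ψ : H)‖ * ‖T ψ‖ := by
      refine hD.induction (P := fun φ : H => ‖⟪φ, T ψ⟫_ℂ‖ ≤ C * ‖(ψ : H)‖ * ‖φ‖) ?_ ?_ (T ψ)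
      · intro φ hφ
        have := hb ⟨φ, hφ⟩ ψ
        rw [← hb₃, ← hT] at this
        simpa [mul_right_comm] using this
      · exact isClosed_le (by fun_prop) (by fun_prop)
    rw [inner_self_eq_norm_sq_to_K] at h
    rcases (norm_nonneg (T ψ)).eq_or_lt with h0 | h0
    · rw [← h0]; positivity
    · simp only [Complex.coe_algebraMap, norm_pow, Complex.norm_real, norm_norm] at h
      rw [sq] at h
      exact le_of_mul_le_mul_right h h0
  refine ContinuousLinearMap.opNorm_le_bound _ hC fun ψ => ?_
  exact hD.induction (P := fun ψ : H => ‖T ψ‖ ≤ C * ‖ψ‖) (fun ψ hψ => hbd ⟨ψ, hψ⟩)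
    (isClosed_le (by fun_prop) (by fun_prop)) ψ

/-- Quadratic bounds of a sesquilinear form are enough to represent it by an operator. -/
theorem exists_operator_of_dense_of_sq_bound {D : Submodule ℂ H} (hD : Dense (D : Set H))
    (b : D →ₗ⋆[ℂ] D →ₗ[ℂ] ℂ) {C : ℝ} (hC : 0 ≤ C)
    (hb : ∀ φ ψ : D, ‖b φ ψ‖ ≤ C / 2 * (‖φ‖ ^ 2 + ‖ψ‖ ^ 2)) :
    ∃ T : H →L[ℂ] H, ‖T‖ ≤ C ∧ ∀ φ ψ : D, ⟪(φ : H), T ψ⟫_ℂ = b φ ψ := by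
  refine exists_operator_of_dense hD b hC fun φ ψ => ?_
  rcases eq_or_ne φ 0 with rfl | hφ
  · simp
  rcases eq_or_ne ψ 0 with rfl | hψ
  · simp
  have hφ' : 0 < ‖φ‖ := norm_pos_iff.2 hφ
  have hψ' : 0 < ‖ψ‖ := norm_pos_iff.2 hψ
  -- At unit vectors the quadratic bound reads `≤ C`; homogeneity does the rest.
  have h := hb (((‖φ‖⁻¹ : ℝ) : ℂ) • φ) (((‖ψ‖⁻¹ : ℝ) : ℂ) • ψ)
  rw [LinearMap.map_smulₛₗ b, LinearMap.smul_apply, map_smul] at h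
  simp only [norm_smul, Complex.norm_real, smul_eq_mul, norm_mul, norm_inv, norm_norm,
    Complex.conj_ofReal, inv_mul_cancel₀ hφ'.ne', inv_mul_cancel₀ hψ'.ne'] at h
  have h2 : ‖b φ ψ‖ = ‖φ‖ * ‖ψ‖ * (‖φ‖⁻¹ * (‖ψ‖⁻¹ * ‖b φ ψ‖)) := by
    field_simp
  rw [h2]
  calc ‖φ‖ * ‖ψ‖ * (‖φ‖⁻¹ * (‖ψ‖⁻¹ * ‖b φ ψ‖)) ≤ ‖φ‖ * ‖ψ‖ * (C / 2 * (1 ^ 2 + 1 ^ 2)) := by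
        gcongr
    _ = C * ‖φ‖ * ‖ψ‖ := by ring

/-- A bounded sequence of operators with convergent quadratic forms has a weak limit. -/
theorem exists_weak_limit {P : ℕ → H →L[ℂ] H} {C : ℝ} (hP : ∀ n, ‖P n‖ ≤ C)
    (h : ∀ ψ, ∃ l : ℂ, Tendsto (fun n => ⟪ψ, P n ψ⟫_ℂ) atTop (𝓝 l)) :
    ∃ T : H →L[ℂ] H, ‖T‖ ≤ C ∧
      ∀ φ ψ, Tendsto (fun n => ⟪φ, P n ψ⟫_ℂ) atTop (𝓝 ⟪φ, T ψ⟫_ℂ) := by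
  have hC : 0 ≤ C := (norm_nonneg _).trans (hP 0)
  have h' : ∀ φ ψ, ∃ l : ℂ, Tendsto (fun n => ⟪φ, P n ψ⟫_ℂ) atTop (𝓝 l) := by
    intro φ ψ
    choose l hl using h
    exact ⟨_, (((((hl (φ + ψ)).sub (hl (φ - ψ))).sub
      ((hl (φ + Complex.I • ψ)).const_mul Complex.I)).add
      ((hl (φ - Complex.I • ψ)).const_mul Complex.I)).div_const 4).congr
      fun n => (inner_polarization (P n) φ ψ).symm⟩
  choose b hb using h'
  let b' : (⊤ : Submodule ℂ H) →ₗ⋆[ℂ] (⊤ : Submodule ℂ H) →ₗ[ℂ] ℂ :=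
    LinearMap.mk₂'ₛₗ _ _ (fun φ ψ => b φ ψ)
      (fun φ₁ φ₂ ψ => tendsto_nhds_unique (hb _ _)
        (((hb φ₁ ψ).add (hb φ₂ ψ)).congr fun n => by simp))
      (fun c φ ψ => tendsto_nhds_unique (hb _ _)
        (((hb φ ψ).const_mul (starRingEnd ℂ c)).congr fun n => by simp [mul_comm]))
      (fun φ ψ₁ ψ₂ => tendsto_nhds_unique (hb _ _)
        (((hb φ ψ₁).add (hb φ ψ₂)).congr fun n => by simp))
      (fun c φ ψ => tendsto_nhds_unique (hb _ _)
        (((hb φ ψ).const_mul c).congr fun n => by simp))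
  obtain ⟨T, hT, hTb⟩ := exists_operator_of_dense (D := ⊤) (by simp) b' hC (by
    intro φ ψ
    refine le_of_tendsto (hb φ ψ).norm (.of_forall fun n => ?_)
    calc ‖⟪(φ : H), P n ψ⟫_ℂ‖ ≤ ‖(φ : H)‖ * (‖P n‖ * ‖(ψ : H)‖) :=
          (norm_inner_le_norm _ _).trans (by gcongr; exact (P n).le_opNorm _)
      _ ≤ ‖(φ : H)‖ * (C * ‖(ψ : H)‖) := by gcongr; exact hP n
      _ = C * ‖φ‖ * ‖ψ‖ := by simp only [Submodule.coe_norm]; ring)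
  refine ⟨T, hT, fun φ ψ => ?_⟩
  have h1 := hTb ⟨φ, trivial⟩ ⟨ψ, trivial⟩
  simp only at h1
  rw [h1]
  exact hb φ ψ

/-- A bounded increasing sequence of operators converges weakly to its least upper bound. -/
theorem exists_weak_limit_of_monotone {P : ℕ → H →L[ℂ] H} {C : ℝ} (hP : ∀ n, ‖P n‖ ≤ C)
    (hmono : Monotone P) : ∃ T : H →L[ℂ] H, ‖T‖ ≤ C ∧
      ∀ φ ψ, Tendsto (fun n => ⟪φ, P n ψ⟫_ℂ) atTop (𝓝 ⟪φ, T ψ⟫_ℂ) := by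
  refine exists_weak_limit hP fun ψ => ?_
  have hre : Monotone fun n => (⟪ψ, P n ψ⟫_ℂ).re := fun m n h =>
    (Complex.le_def.1 (le_iff_inner.1 (hmono h) ψ)).1
  -- Comparability in the order of `ℂ` forces equal imaginary parts, so only the real parts move.
  have him : ∀ n, (⟪ψ, P n ψ⟫_ℂ).im = (⟪ψ, P 0 ψ⟫_ℂ).im := fun n =>
    ((Complex.le_def.1 (le_iff_inner.1 (hmono (Nat.zero_le n)) ψ)).2).symm
  have hbd : BddAbove (range fun n => (⟪ψ, P n ψ⟫_ℂ).re) := by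
    refine ⟨C * ‖ψ‖ * ‖ψ‖, ?_⟩
    rintro _ ⟨n, rfl⟩
    exact (Complex.re_le_norm _).trans (norm_inner_operator_le _ _ _ (hP n))
  have hlim := (Complex.continuous_ofReal.tendsto _).comp (tendsto_atTop_ciSup hre hbd)
  refine ⟨_, (hlim.add_const ((⟪ψ, P 0 ψ⟫_ℂ).im * Complex.I)).congr fun n => ?_⟩
  simp only [Function.comp]
  rw [← him n, Complex.re_add_im]

/-- A bounded increasing sequence of operators converges weakly to any least upper bound. -/
theorem tendsto_of_isLUB {P : ℕ → H →L[ℂ] H} {C : ℝ} (hP : ∀ n, ‖P n‖ ≤ C)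
    (hmono : Monotone P) {T : H →L[ℂ] H} (hT : IsLUB (range P) T) (φ ψ : H) :
    Tendsto (fun n => ⟪φ, P n ψ⟫_ℂ) atTop (𝓝 ⟪φ, T ψ⟫_ℂ) := by
  obtain ⟨T', -, hT'⟩ := exists_weak_limit_of_monotone hP hmono
  rw [hT.unique (isLUB_of_weak_limit hmono hT')]
  exact hT' φ ψ

theorem le_norm_smul_one {A : H →L[ℂ] H} (hA : 0 ≤ A) : A ≤ (‖A‖ : ℂ) • (1 : H →L[ℂ] H) := by
  have := IsSelfAdjoint.le_algebraMap_norm_self (a := A) (.of_nonneg hA)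
  rw [Algebra.algebraMap_eq_smul_one] at this
  simpa using this

theorem exists_star_mul_self {A : H →L[ℂ] H} (hA : 0 ≤ A) : ∃ B : H →L[ℂ] H, star B * B = A := by
  obtain ⟨B, hB⟩ := CStarAlgebra.nonneg_iff_eq_star_mul_self.1 hA
  exact ⟨B, hB.symm⟩

end Operators

end MarkovMaster

/-! ### Cores, completely positive form maps, contraction semigroups. -/

namespace MarkovMaster

variable {H : Type*} [NormedAddCommGroup H] [InnerProductSpace ℂ H]

/-- A core of a densely defined operator is dense. -/
theorem dense_of_hasCore {G : H →ₗ.[ℂ] H} {D : Submodule ℂ H} (hG : Dense (G.domain : Set H))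
    (hD : G.HasCore D) : Dense (D : Set H) := by
  have hdom : (G.domRestrict D).domain = D := inf_eq_left.2 hD.le_domain
  by_cases hcl : (G.domRestrict D).IsClosable
  · have hgr := hcl.graph_closure_eq_closure_graph
    rw [hD.closure_eq] at hgr
    refine dense_closure.1 (hG.mono fun ψ hψ => ?_)
    have h1 : (ψ, G ⟨ψ, hψ⟩) ∈ (G.domRestrict D).graph.topologicalClosure := by
      rw [hgr]
      exact G.mem_graph ⟨ψ, hψ⟩
    rw [← SetLike.mem_coe, Submodule.topologicalClosure_coe] at h1
    refine map_mem_closure continuous_fst h1 fun p hp => ?_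
    rw [SetLike.mem_coe, ← hdom]
    exact LinearPMap.mem_domain_of_mem_graph hp
  -- For a non-closable operator `LinearPMap.closure` defaults to the operator itself, so here `D`
  -- is the whole domain of `G`.
  · have := hD.closure_eq
    rw [LinearPMap.closure, dif_neg hcl] at this
    rwa [← hdom, this]

variable [CompleteSpace H]

namespace CPFormMap

variable (Φ : CPFormMap H)

theorem val_of_mem (X : H →L[ℂ] H) {φ ψ : H} (hφ : φ ∈ Φ.formDomain) (hψ : ψ ∈ Φ.formDomain) :
    Φ.val X φ ψ = Φ.form X ⟨φ, hφ⟩ ⟨ψ, hψ⟩ := by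
  simp [val, hφ, hψ]

theorem val_add_op (X Y : H →L[ℂ] H) (φ ψ : H) :
    Φ.val (X + Y) φ ψ = Φ.val X φ ψ + Φ.val Y φ ψ := by
  unfold val
  split_ifs <;> simp

theorem val_smul_op (c : ℂ) (X : H →L[ℂ] H) (φ ψ : H) :
    Φ.val (c • X) φ ψ = c * Φ.val X φ ψ := by
  unfold val
  split_ifs <;> simp

theorem val_sub_op (X Y : H →L[ℂ] H) (φ ψ : H) :
    Φ.val (X - Y) φ ψ = Φ.val X φ ψ - Φ.val Y φ ψ := by
  unfold val
  split_ifs <;> simp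

variable {Φ}

theorem val_add_left (X : H →L[ℂ] H) {φ₁ φ₂ ψ : H} (h₁ : φ₁ ∈ Φ.formDomain)
    (h₂ : φ₂ ∈ Φ.formDomain) (h : ψ ∈ Φ.formDomain) :
    Φ.val X (φ₁ + φ₂) ψ = Φ.val X φ₁ ψ + Φ.val X φ₂ ψ := by
  rw [Φ.val_of_mem X h₁ h, Φ.val_of_mem X h₂ h, Φ.val_of_mem X (add_mem h₁ h₂) h,
    ← LinearMap.add_apply, ← map_add]
  rfl

theorem val_smul_left (X : H →L[ℂ] H) (c : ℂ) {φ ψ : H} (h₁ : φ ∈ Φ.formDomain)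
    (h : ψ ∈ Φ.formDomain) : Φ.val X (c • φ) ψ = starRingEnd ℂ c * Φ.val X φ ψ := by
  rw [Φ.val_of_mem X h₁ h, Φ.val_of_mem X (Submodule.smul_mem _ c h₁) h, ← smul_eq_mul,
    ← LinearMap.smul_apply, ← LinearMap.map_smulₛₗ (Φ.form X)]
  rfl

theorem val_add_right (X : H →L[ℂ] H) {φ ψ₁ ψ₂ : H} (h : φ ∈ Φ.formDomain)
    (h₁ : ψ₁ ∈ Φ.formDomain) (h₂ : ψ₂ ∈ Φ.formDomain) :
    Φ.val X φ (ψ₁ + ψ₂) = Φ.val X φ ψ₁ + Φ.val X φ ψ₂ := by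
  rw [Φ.val_of_mem X h h₁, Φ.val_of_mem X h h₂, Φ.val_of_mem X h (add_mem h₁ h₂), ← map_add]
  rfl

theorem val_smul_right (X : H →L[ℂ] H) (c : ℂ) {φ ψ : H} (h : φ ∈ Φ.formDomain)
    (h₁ : ψ ∈ Φ.formDomain) : Φ.val X φ (c • ψ) = c * Φ.val X φ ψ := by
  rw [Φ.val_of_mem X h h₁, Φ.val_of_mem X h (Submodule.smul_mem _ c h₁), ← smul_eq_mul,
    ← map_smul]
  rfl

/-- Complete positivity with a single term, applied to `X = B* B`; off the form domain the value is
`0`. -/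
theorem val_nonneg {X : H →L[ℂ] H} (hX : 0 ≤ X) (ψ : H) : 0 ≤ Φ.val X ψ ψ := by
  obtain ⟨B, rfl⟩ := exists_star_mul_self hX
  by_cases h : ψ ∈ Φ.formDomain
  · rw [Φ.val_of_mem _ h h]
    simpa using Φ.completelyPositive 1 (fun _ => B) fun _ => ⟨ψ, h⟩
  · simp [val, h]

theorem val_mono {X Y : H →L[ℂ] H} (h : X ≤ Y) (ψ : H) : Φ.val X ψ ψ ≤ Φ.val Y ψ ψ := by
  have := Φ.val_nonneg (sub_nonneg.2 h) ψ
  rwa [val_sub_op, sub_nonneg] at this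

/-- The Cauchy–Schwarz inequality for a completely positive form-valued map. -/
theorem norm_val_le (X : H →L[ℂ] H) {φ ψ : H} (hφ : φ ∈ Φ.formDomain) (hψ : ψ ∈ Φ.formDomain) :
    ‖Φ.val X φ ψ‖ ≤ ‖X‖ / 2 * ((Φ.val 1 φ φ).re + (Φ.val 1 ψ ψ).re) := by
  rcases (norm_nonneg X).eq_or_lt with h0 | h0
  · have hX : X = 0 := norm_eq_zero.1 h0.symm
    rw [Φ.val_of_mem _ hφ hψ]
    simp [hX]
  set c := ‖X‖
  set α := Φ.val X φ ψ
  set β := Φ.val (star X) ψ φ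
  set p := Φ.val 1 φ φ
  set q := Φ.val (star X * X) ψ ψ
  -- Complete positivity for the operators `c·1, X` at the vectors `φ, zψ`.
  have key : ∀ z : ℂ, 0 ≤ (c : ℂ) ^ 2 * p + c * z * α + c * starRingEnd ℂ z * β
      + starRingEnd ℂ z * z * q := by
    intro z
    have h := Φ.completelyPositive 2 ![(c : ℂ) • 1, X] ![⟨φ, hφ⟩, z • ⟨ψ, hψ⟩]
    simp only [Fin.sum_univ_two, Matrix.cons_val_zero, Matrix.cons_val_one] at h
    have e : ∀ (Y : H →L[ℂ] H) (u v : Φ.formDomain), Φ.form Y u v = Φ.val Y u v := fun Y u v =>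
      (Φ.val_of_mem Y u.2 v.2).symm
    simp only [e, Submodule.coe_smul] at h
    rw [val_smul_right _ _ hφ hψ, val_smul_left _ _ hψ hφ,
      val_smul_left _ _ hψ (Submodule.smul_mem _ z hψ), val_smul_right _ _ hψ hψ] at h
    simp only [star_smul, star_one, smul_mul_assoc, mul_smul_comm, one_mul, mul_one, val_smul_op,
      Complex.star_def, Complex.conj_ofReal] at h
    convert h using 1
    ring
  have hp : 0 ≤ p := val_nonneg zero_le_one φ
  have hq : 0 ≤ q := val_nonneg (star_mul_self_nonneg X) ψ
  have hqle : q ≤ (c : ℂ) ^ 2 * Φ.val 1 ψ ψ := by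
    rw [← val_smul_op]
    refine val_mono ?_ ψ
    have := CStarAlgebra.star_mul_le_algebraMap_norm_sq (a := X)
    rw [Algebra.algebraMap_eq_smul_one] at this
    rw [← Complex.ofReal_pow]
    exact this
  rw [Complex.nonneg_iff] at hp hq
  have hqre := (Complex.le_def.1 hqle).1
  rw [← Complex.ofReal_pow, Complex.re_ofReal_mul] at hqre
  -- Hermitian symmetry of `Φ` is not postulated; it follows from reality of `key` at `z = 1` and `z
  -- = i`.
  have hβ : β = starRingEnd ℂ α := by
    have h1 := (Complex.nonneg_iff.1 (key 1)).2
    have h2 := (Complex.nonneg_iff.1 (key Complex.I)).2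
    simp only [← Complex.ofReal_pow, Complex.add_im, Complex.mul_im, Complex.mul_re,
      Complex.ofReal_re, Complex.ofReal_im, map_one, Complex.one_re, Complex.one_im, Complex.conj_I,
      Complex.neg_re, Complex.neg_im, Complex.I_re, Complex.I_im, ← hp.2, ← hq.2] at h1 h2
    apply Complex.ext
    · rw [Complex.conj_re]
      have : c * (α.re - β.re) = 0 := by linarith
      rcases mul_eq_zero.1 this with h | h
      · exact absurd h h0.ne'
      · linarith
    · rw [Complex.conj_im]
      have : c * (α.im + β.im) = 0 := by linarith
      rcases mul_eq_zero.1 this with h | h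
      · exact absurd h h0.ne'
      · linarith
  rcases (norm_nonneg α).eq_or_lt with hα | hα
  · rw [← hα]
    have : 0 ≤ (Φ.val 1 ψ ψ).re := (Complex.nonneg_iff.1 (val_nonneg zero_le_one ψ)).1
    have := hp.1
    positivity
  -- This phase turns the two cross terms into `-2c‖α‖`; dividing by `c` and using `q ≤ c² Φ(I)[ψ]`
  -- gives the bound.
  have h := key (-(starRingEnd ℂ α) / ‖α‖)
  have hαc : (‖α‖ : ℂ) ≠ 0 := by exact_mod_cast hα.ne'
  have hαα : starRingEnd ℂ α * α = (‖α‖ : ℂ) ^ 2 := Complex.conj_mul' α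
  have e : (c : ℂ) ^ 2 * p + c * (-(starRingEnd ℂ α) / ‖α‖) * α
      + c * starRingEnd ℂ (-(starRingEnd ℂ α) / ‖α‖) * β
      + starRingEnd ℂ (-(starRingEnd ℂ α) / ‖α‖) * (-(starRingEnd ℂ α) / ‖α‖) * q
      = ((c ^ 2 : ℝ) : ℂ) * p - ((2 * c * ‖α‖ : ℝ) : ℂ) + q := by
    rw [hβ]
    simp only [map_div₀, map_neg, Complex.conj_conj, Complex.conj_ofReal]
    push_cast
    field_simp
    linear_combination (q - 2 * c * ‖α‖) * hαα
  rw [e] at h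
  have h1 := (Complex.nonneg_iff.1 h).1
  rw [Complex.add_re, Complex.sub_re, Complex.re_ofReal_mul, Complex.ofReal_re] at h1
  have h2 : c * ‖α‖ ≤ c * (c / 2 * (p.re + (Φ.val 1 ψ ψ).re)) := by nlinarith
  exact le_of_mul_le_mul_left h2 h0

end CPFormMap

namespace ContractionSemigroup

variable (W : ContractionSemigroup H)

theorem op_comm {s t : ℝ} (hs : 0 ≤ s) (ht : 0 ≤ t) (ψ : H) :
    W.op s (W.op t ψ) = W.op t (W.op s ψ) := by
  have h1 := W.op_add s t hs ht
  rw [add_comm, W.op_add t s ht hs] at h1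
  exact (congrArg (fun A : H →L[ℂ] H => A ψ) h1).symm

/-- The extension of a semigroup to all times by the identity at negative times. -/
noncomputable def opReal (t : ℝ) : H →L[ℂ] H := W.op (max t 0)

theorem opReal_of_nonneg {t : ℝ} (ht : 0 ≤ t) : W.opReal t = W.op t := by
  rw [opReal, max_eq_left ht]

theorem norm_opReal_le (t : ℝ) : ‖W.opReal t‖ ≤ 1 := W.norm_op_le _ (le_max_right _ _)

theorem continuous_opReal (ψ : H) : Continuous fun t => W.opReal t ψ :=
  (W.continuousOn_op ψ).comp_continuous (continuous_id.max continuous_const) fun _ =>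
    mem_Ici.2 (le_max_right _ _)

variable {W} {G : H →ₗ.[ℂ] H}

theorem IsGeneratedBy.op_mem_graph (hW : W.IsGeneratedBy G) {ψ η : H} (h : (ψ, η) ∈ G.graph)
    {s : ℝ} (hs : 0 ≤ s) : (W.op s ψ, W.op s η) ∈ G.graph := by
  rw [hW] at h ⊢
  refine (((W.op s).continuous.tendsto _).comp h).congr' ?_
  filter_upwards [self_mem_nhdsWithin] with t ht
  simp only [Function.comp]
  rw [ContinuousLinearMap.map_smul_of_tower, map_sub, W.op_comm hs (le_of_lt ht)]

/-- Orbits in the domain of the generator are right differentiable. -/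
theorem IsGeneratedBy.hasDerivWithinAt_opReal (hW : W.IsGeneratedBy G) {ψ η : H}
    (h : (ψ, η) ∈ G.graph) {s : ℝ} (hs : 0 ≤ s) :
    HasDerivWithinAt (fun t => W.opReal t ψ) (-W.opReal s η) (Ioi s) s := by
  have h1 := (hW _ _).1 (hW.op_mem_graph h hs)
  rw [hasDerivWithinAt_iff_tendsto_slope' (by simp), W.opReal_of_nonneg hs]
  have h2 : Tendsto (fun t : ℝ => t - s) (𝓝[>] s) (𝓝[>] 0) := by
    refine tendsto_nhdsWithin_iff.2 ⟨?_, ?_⟩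
    · have : Tendsto (fun t : ℝ => t - s) (𝓝 s) (𝓝 (s - s)) := by
        exact (continuous_id.sub continuous_const).tendsto s
      rw [sub_self] at this
      exact this.mono_left nhdsWithin_le_nhds
    · filter_upwards [self_mem_nhdsWithin] with t ht
      exact sub_pos.2 (mem_Ioi.1 ht)
  refine (h1.comp h2).neg.congr' ?_
  filter_upwards [self_mem_nhdsWithin] with t ht
  have ht' : s < t := ht
  have e : W.op t ψ = W.op (t - s) (W.op s ψ) := by
    conv_lhs => rw [← sub_add_cancel t s, W.op_add _ _ (sub_nonneg.2 ht'.le) hs]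
    rfl
  rw [slope_def_module, W.opReal_of_nonneg hs, W.opReal_of_nonneg (hs.trans ht'.le), e]
  simp only [Function.comp, ← smul_neg, neg_sub]

/-- Integrals of orbits lie in the domain of the generator. -/
theorem IsGeneratedBy.integral_mem_domain (hW : W.IsGeneratedBy G) (ψ : H) {h : ℝ} (hh : 0 ≤ h) :
    ∫ s in (0 : ℝ)..h, W.opReal s ψ ∈ G.domain := by
  have hc := W.continuous_opReal ψ
  have hi : ∀ a b : ℝ, IntervalIntegrable (fun s => W.opReal s ψ) volume a b := fun a b =>
    hc.intervalIntegrable a b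
  refine LinearPMap.mem_domain_of_mem_graph (y := ψ - W.opReal h ψ) ((hW _ _).2 ?_)
  have hd : ∀ b : ℝ, HasDerivAt (fun u => ∫ s in (0 : ℝ)..u, W.opReal s ψ) (W.opReal b ψ) b :=
    fun b => intervalIntegral.integral_hasDerivAt_right (hi _ _)
      (hc.stronglyMeasurableAtFilter _ _) hc.continuousAt
  -- The difference quotient of the orbit of `∫₀ʰ W_s ψ ds` is that of `u ↦ ∫₀ᵘ - ∫ᵤ₊ₕ`-type
  -- primitives, `∫₀ᵘ W_s ψ ds - ∫₀ᵘ⁺ʰ W_s ψ ds`, at `0`.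
  have hshift : HasDerivAt (fun u => ∫ s in (0 : ℝ)..(u + h), W.opReal s ψ) (W.opReal h ψ) 0 := by
    have := hd (0 + h)
    simpa using this.comp_add_const 0 h
  have hdiff := ((hd 0).sub hshift).hasDerivWithinAt (s := Ioi 0)
  rw [hasDerivWithinAt_iff_tendsto_slope' (by simp), W.opReal_of_nonneg le_rfl, W.op_zero] at hdiff
  refine hdiff.congr' ?_
  filter_upwards [self_mem_nhdsWithin] with t ht
  have ht' : 0 < t := ht
  have e : W.op t (∫ s in (0 : ℝ)..h, W.opReal s ψ) = ∫ s in t..(t + h), W.opReal s ψ := by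
    rw [← ContinuousLinearMap.intervalIntegral_comp_comm _ (hi _ _)]
    have : ∀ s ∈ uIcc 0 h, W.op t (W.opReal s ψ) = W.opReal (s + t) ψ := by
      intro s hs
      rw [uIcc_of_le hh] at hs
      rw [W.opReal_of_nonneg hs.1, W.opReal_of_nonneg (add_nonneg hs.1 ht'.le), add_comm,
        W.op_add _ _ ht'.le hs.1]
      rfl
    rw [intervalIntegral.integral_congr this,
      intervalIntegral.integral_comp_add_right (fun s => W.opReal s ψ) t, zero_add, add_comm h t]
  have e2 := intervalIntegral.integral_add_adjacent_intervals (hi 0 t) (hi t (t + h))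
  rw [slope_def_module, e]
  simp only [Pi.sub_apply, intervalIntegral.integral_same, sub_zero, zero_add, ← e2]
  congr 1
  abel

/-- The generator of a strongly continuous semigroup is densely defined. -/
theorem IsGeneratedBy.dense_domain (hW : W.IsGeneratedBy G) : Dense (G.domain : Set H) := by
  intro ψ
  have hc := W.continuous_opReal ψ
  have hd : HasDerivAt (fun u => ∫ s in (0 : ℝ)..u, W.opReal s ψ) (W.opReal 0 ψ) 0 :=
    intervalIntegral.integral_hasDerivAt_right (hc.intervalIntegrable _ _)
      (hc.stronglyMeasurableAtFilter _ _) hc.continuousAt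
  have hdiff := hd.hasDerivWithinAt (s := Ioi 0)
  rw [hasDerivWithinAt_iff_tendsto_slope' (by simp), W.opReal_of_nonneg le_rfl, W.op_zero] at hdiff
  refine mem_closure_of_tendsto hdiff ?_
  filter_upwards [self_mem_nhdsWithin] with t ht
  rw [slope_def_module]
  simp only [intervalIntegral.integral_same, sub_zero]
  rw [RCLike.real_smul_eq_coe_smul (K := ℂ)]
  exact Submodule.smul_mem _ _ (hW.integral_mem_domain ψ (le_of_lt ht))

end ContractionSemigroup

end MarkovMaster

/-! ### Construction of the iterates. -/

namespace MarkovMaster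

variable {H : Type*} [NormedAddCommGroup H] [InnerProductSpace ℂ H]

/-- The bounded weakly continuous families of operators on which the master equation acts. -/
structure IsWeaklyContinuousBounded (K : ℝ → H →L[ℂ] H) (C : ℝ) : Prop where
  norm_le : ∀ s, ‖K s‖ ≤ C
  continuous_inner : ∀ φ ψ, Continuous fun s => ⟪φ, K s ψ⟫_ℂ

theorem isWeaklyContinuousBounded_const (B : H →L[ℂ] H) :
    IsWeaklyContinuousBounded (fun _ => B) ‖B‖ :=
  ⟨fun _ => le_rfl, fun _ _ => continuous_const⟩

variable [CompleteSpace H]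

namespace FormalGenerator

variable {L : FormalGenerator H} {W : ContractionSemigroup H} {N : ℕ}

theorem DomainAssumptions.dense (hdom : L.DomainAssumptions W N) (hW : W.IsGeneratedBy L.G) :
    Dense (powDomain L.G N : Set H) :=
  dense_of_hasCore hW.dense_domain hdom.hasCore

theorem DomainAssumptions.opReal_mem (hdom : L.DomainAssumptions W N) (t : ℝ) {ψ : H}
    (hψ : ψ ∈ powDomain L.G N) : W.opReal t ψ ∈ powDomain L.G N :=
  hdom.invariant _ (le_max_right _ _) ψ hψ

theorem DomainAssumptions.opReal_mem_formDomain (hdom : L.DomainAssumptions W N) (t : ℝ) {ψ : H}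
    (hψ : ψ ∈ powDomain L.G N) : W.opReal t ψ ∈ L.Φ.formDomain :=
  hdom.le_formDomain (hdom.opReal_mem t hψ)

/-- The form `Φ` is jointly continuous along orbits of the semigroup. -/
theorem ContinuityConditions.continuous_val (hcont : L.ContinuityConditions W N)
    {K : ℝ → H →L[ℂ] H} {C : ℝ} (hK : IsWeaklyContinuousBounded K C) {φ ψ : H}
    (hφ : φ ∈ powDomain L.G N) (hψ : ψ ∈ powDomain L.G N) :
    Continuous fun p : ℝ × ℝ => L.Φ.val (K p.1) (W.opReal p.2 φ) (W.opReal p.2 ψ) := by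
  obtain ⟨-, S, -, -, -, -, -, ⟨A, hA, hval⟩, hf⟩ := hcont
  have hf' : ∀ ψ ∈ powDomain L.G N, ∃ g : ℝ → H, Continuous g ∧
      ∀ t, (W.opReal t ψ, g t) ∈ S.graph := by
    intro ψ hψ
    obtain ⟨f, hfc, hfS⟩ := hf ψ hψ
    exact ⟨fun t => f (max t 0), hfc.comp_continuous (continuous_id.max continuous_const)
      fun _ => mem_Ici.2 (le_max_right _ _), fun t => hfS _ (le_max_right _ _)⟩
  obtain ⟨f, hfc, hfS⟩ := hf' φ hφ
  obtain ⟨g, hgc, hgS⟩ := hf' ψ hψ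
  have hAK : ∀ s, ‖A (K s)‖ ≤ ‖A‖ * C := fun s =>
    (A.le_opNorm _).trans (by gcongr; exact hK.norm_le s)
  -- The value is `⟪Λ^{1/2} W φ, A(K_s) Λ^{1/2} W ψ⟫`: the vectors are norm continuous, and
  -- normality keeps `A(K_s)` weakly continuous.
  have h1 := (continuous_inner_operator hAK
    (hA.continuous_inner hK.norm_le hK.continuous_inner)).comp
    (continuous_fst.prodMk ((hfc.comp continuous_snd).prodMk (hgc.comp continuous_snd)) :
      Continuous fun p : ℝ × ℝ => (p.1, f p.2, g p.2))
  refine h1.congr fun p => ?_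
  obtain ⟨u, hu, hu'⟩ := (S.mem_graph_iff).1 (hfS p.2)
  obtain ⟨v, hv, hv'⟩ := (S.mem_graph_iff).1 (hgS p.2)
  simp only at hu hu' hv hv'
  simp only [Function.comp]
  rw [← hu, ← hv, hval, hu', hv']

theorem ContinuityConditions.continuous_val_sub (hcont : L.ContinuityConditions W N)
    {K : ℝ → H →L[ℂ] H} {C : ℝ} (hK : IsWeaklyContinuousBounded K C) {φ ψ : H}
    (hφ : φ ∈ powDomain L.G N) (hψ : ψ ∈ powDomain L.G N) (t : ℝ) :
    Continuous fun s => L.Φ.val (K s) (W.opReal (t - s) φ) (W.opReal (t - s) ψ) :=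
  (hcont.continuous_val hK hφ hψ).comp
    (continuous_id.prodMk (continuous_const.sub continuous_id))

/-- The energy balance `‖ψ‖² - ‖W_t ψ‖² = ∫₀ᵗ Φ(I)[W_s ψ] ds`. -/
theorem DomainAssumptions.integral_val_one (hdom : L.DomainAssumptions W N)
    (hW : W.IsGeneratedBy L.G) (hcont : L.ContinuityConditions W N) {ψ : H}
    (hψ : ψ ∈ powDomain L.G N) {t : ℝ} (ht : 0 ≤ t) :
    ∫ s in (0 : ℝ)..t, L.Φ.val 1 (W.opReal (t - s) ψ) (W.opReal (t - s) ψ)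
      = ⟪ψ, ψ⟫_ℂ - ⟪W.opReal t ψ, W.opReal t ψ⟫_ℂ := by
  rw [intervalIntegral.integral_comp_sub_left
    (fun s => L.Φ.val 1 (W.opReal s ψ) (W.opReal s ψ)) t, sub_zero, sub_self]
  have hdm := hdom.hasCore.le_domain hψ
  set η := L.G ⟨ψ, hdm⟩
  have hgr : (ψ, η) ∈ L.G.graph := L.G.mem_graph ⟨ψ, hdm⟩
  have hc : Continuous fun s => L.Φ.val 1 (W.opReal s ψ) (W.opReal s ψ) :=
    (hcont.continuous_val (isWeaklyContinuousBounded_const 1) hψ hψ).comp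
      (continuous_const.prodMk continuous_id : Continuous fun s : ℝ => ((0 : ℝ), s))
  have hval : ∀ s, 0 ≤ s → L.Φ.val 1 (W.opReal s ψ) (W.opReal s ψ)
      = ⟪W.opReal s η, W.opReal s ψ⟫_ℂ + ⟪W.opReal s ψ, W.opReal s η⟫_ℂ := by
    intro s hs
    have h1 := hW.op_mem_graph hgr hs
    rw [← W.opReal_of_nonneg hs] at h1
    obtain ⟨u, hu, hu'⟩ := (L.G.mem_graph_iff).1 h1
    simp only at hu hu'
    have hm := hdom.opReal_mem s hψ
    rw [← hu] at hm
    have h2 := hdom.adjoint_add u u hm hm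
    rw [hu', hu] at h2
    exact h2.symm
  -- By `hval` the integrand is the right derivative of `-‖W_s ψ‖²`; a right derivative suffices for
  -- a continuous primitive.
  have h := intervalIntegral.integral_eq_sub_of_hasDeriv_right (a := 0) (b := t)
    (f := fun s => -⟪W.opReal s ψ, W.opReal s ψ⟫_ℂ)
    (f' := fun s => L.Φ.val 1 (W.opReal s ψ) (W.opReal s ψ))
    (((W.continuous_opReal ψ).inner (W.continuous_opReal ψ)).neg).continuousOn
    (fun s hs => by
      have hs0 : 0 ≤ s := by
        have := hs.1
        rw [min_eq_left ht] at this
        exact this.le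
      have hd := hW.hasDerivWithinAt_opReal hgr hs0
      have := (hd.inner ℂ hd).neg
      refine this.congr_deriv ?_
      rw [hval s hs0, inner_neg_left, inner_neg_right]
      ring) (hc.intervalIntegrable _ _)
  rw [h, W.opReal_of_nonneg le_rfl, W.op_zero]
  simp only [one_apply_eq_self]
  ring

/-- One step of the iteration of the integral master equation. -/
theorem exists_iteration_step (hdom : L.DomainAssumptions W N) (hW : W.IsGeneratedBy L.G)
    (hcont : L.ContinuityConditions W N) (B : H →L[ℂ] H) {K : ℝ → H →L[ℂ] H}
    (hK : IsWeaklyContinuousBounded K ‖B‖) :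
    ∃ K' : ℝ → H →L[ℂ] H, IsWeaklyContinuousBounded K' ‖B‖ ∧
      ∀ t, 0 ≤ t → ∀ φ ∈ powDomain L.G N, ∀ ψ ∈ powDomain L.G N,
        ⟪φ, K' t ψ⟫_ℂ = ⟪W.opReal t φ, B (W.opReal t ψ)⟫_ℂ
          + ∫ s in (0 : ℝ)..t, L.Φ.val (K s) (W.opReal (t - s) φ) (W.opReal (t - s) ψ) := by
  set D := powDomain L.G N
  have hD := hdom.dense hW
  have hi : ∀ t a b, ∀ φ ∈ D, ∀ ψ ∈ D, IntervalIntegrable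
      (fun s => L.Φ.val (K s) (W.opReal (t - s) φ) (W.opReal (t - s) ψ)) volume a b :=
    fun t a b φ hφ ψ hψ => (hcont.continuous_val_sub hK hφ hψ t).intervalIntegrable a b
  have hm : ∀ (r : ℝ) (ψ : D), W.opReal r ψ ∈ L.Φ.formDomain := fun r ψ =>
    hdom.opReal_mem_formDomain r ψ.2
  let b : ℝ → D →ₗ⋆[ℂ] D →ₗ[ℂ] ℂ := fun t => LinearMap.mk₂'ₛₗ _ _
    (fun φ ψ => ⟪W.opReal t φ, B (W.opReal t ψ)⟫_ℂ
      + ∫ s in (0 : ℝ)..t, L.Φ.val (K s) (W.opReal (t - s) φ) (W.opReal (t - s) ψ))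
    (fun φ₁ φ₂ ψ => by
      simp only [Submodule.coe_add, map_add, inner_add_left,
        CPFormMap.val_add_left _ (hm _ φ₁) (hm _ φ₂) (hm _ ψ)]
      rw [intervalIntegral.integral_add (hi _ _ _ _ φ₁.2 _ ψ.2) (hi _ _ _ _ φ₂.2 _ ψ.2)]
      ring)
    (fun c φ ψ => by
      simp only [Submodule.coe_smul, map_smul, inner_smul_left,
        CPFormMap.val_smul_left _ c (hm _ φ) (hm _ ψ)]
      rw [intervalIntegral.integral_const_mul, smul_eq_mul]
      ring)
    (fun φ ψ₁ ψ₂ => by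
      simp only [Submodule.coe_add, map_add, inner_add_right,
        CPFormMap.val_add_right _ (hm _ φ) (hm _ ψ₁) (hm _ ψ₂)]
      rw [intervalIntegral.integral_add (hi _ _ _ _ φ.2 _ ψ₁.2) (hi _ _ _ _ φ.2 _ ψ₂.2)]
      ring)
    (fun c φ ψ => by
      simp only [Submodule.coe_smul, map_smul, inner_smul_right,
        CPFormMap.val_smul_right _ c (hm _ φ) (hm _ ψ)]
      rw [intervalIntegral.integral_const_mul, RingHom.id_apply, smul_eq_mul]
      ring)
  have hb : ∀ t φ ψ, b t φ ψ = ⟪W.opReal t φ, B (W.opReal t ψ)⟫_ℂ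
      + ∫ s in (0 : ℝ)..t, L.Φ.val (K s) (W.opReal (t - s) φ) (W.opReal (t - s) ψ) :=
    fun t φ ψ => rfl
  have hone : ∀ t, 0 ≤ t → ∀ ψ : D, ∫ s in (0 : ℝ)..t,
      (L.Φ.val 1 (W.opReal (t - s) ψ) (W.opReal (t - s) ψ)).re
        = ‖ψ‖ ^ 2 - ‖W.opReal t ψ‖ ^ 2 := by
    intro t ht ψ
    have h1 := hdom.integral_val_one hW hcont ψ.2 ht
    have hint := (hcont.continuous_val_sub (isWeaklyContinuousBounded_const 1) ψ.2 ψ.2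
      t).intervalIntegrable (μ := volume) 0 t
    have h2 := Complex.reCLM.intervalIntegral_comp_comm hint
    simp only [Complex.reCLM_apply] at h2
    have h3 : ∀ x : H, (⟪x, x⟫_ℂ).re = ‖x‖ ^ 2 := inner_self_eq_norm_sq (𝕜 := ℂ)
    rw [h2, h1, Complex.sub_re, h3, h3, Submodule.coe_norm]
  -- Cauchy–Schwarz and the energy balance bound the integral by `‖B‖/2` times the norm squares lost
  -- along the orbits; the free term accounts for those remaining. They add up to the same constant
  -- `‖B‖`, so the bound does not grow with the iteration.
  have hbound : ∀ t, 0 ≤ t → ∀ φ ψ, ‖b t φ ψ‖ ≤ ‖B‖ / 2 * (‖φ‖ ^ 2 + ‖ψ‖ ^ 2) := by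
    intro t ht φ ψ
    have hre : ∀ χ : D, Continuous fun s =>
        (L.Φ.val 1 (W.opReal (t - s) χ) (W.opReal (t - s) χ)).re := fun χ =>
      Complex.continuous_re.comp
        (hcont.continuous_val_sub (isWeaklyContinuousBounded_const 1) χ.2 χ.2 t)
    have h1 : ‖∫ s in (0 : ℝ)..t, L.Φ.val (K s) (W.opReal (t - s) φ) (W.opReal (t - s) ψ)‖
        ≤ ∫ s in (0 : ℝ)..t, ‖B‖ / 2 * ((L.Φ.val 1 (W.opReal (t - s) φ) (W.opReal (t - s) φ)).re
          + (L.Φ.val 1 (W.opReal (t - s) ψ) (W.opReal (t - s) ψ)).re) := by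
      refine intervalIntegral.norm_integral_le_of_norm_le ht (.of_forall fun s _ => ?_)
        ((((hre φ).add (hre ψ)).const_mul _).intervalIntegrable _ _)
      refine (CPFormMap.norm_val_le (K s) (hm _ φ) (hm _ ψ)).trans ?_
      have e : ∀ χ : H, 0 ≤ (L.Φ.val 1 χ χ).re := fun χ =>
        (Complex.nonneg_iff.1 (CPFormMap.val_nonneg zero_le_one χ)).1
      have e1 := e (W.opReal (t - s) φ)
      have e2 := e (W.opReal (t - s) ψ)
      gcongr
      exact hK.norm_le s
    rw [intervalIntegral.integral_const_mul, intervalIntegral.integral_add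
      ((hre φ).intervalIntegrable _ _) ((hre ψ).intervalIntegrable _ _), hone t ht, hone t ht] at h1
    have h2 := norm_inner_operator_le B (W.opReal t φ) (W.opReal t ψ) le_rfl
    have h3 : ‖B‖ * ‖W.opReal t φ‖ * ‖W.opReal t ψ‖
        ≤ ‖B‖ / 2 * (‖W.opReal t φ‖ ^ 2 + ‖W.opReal t ψ‖ ^ 2) := by
      nlinarith [mul_nonneg (norm_nonneg B) (sq_nonneg (‖W.opReal t φ‖ - ‖W.opReal t ψ‖))]
    rw [hb]
    refine (norm_add_le _ _).trans ?_
    linarith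
  have hex : ∀ t : ℝ, ∃ T : H →L[ℂ] H, ‖T‖ ≤ ‖B‖ ∧
      ∀ φ ψ : D, ⟪(φ : H), T ψ⟫_ℂ = b (max t 0) φ ψ := fun t =>
    exists_operator_of_dense_of_sq_bound hD (b (max t 0)) (norm_nonneg _)
      (hbound _ (le_max_right _ _))
  choose K' hK'n hK'b using hex
  refine ⟨K', ⟨hK'n, continuous_inner_of_dense hD hK'n fun φ hφ ψ hψ => ?_⟩, ?_⟩
  · have hjoint : Continuous fun t => b t ⟨φ, hφ⟩ ⟨ψ, hψ⟩ := by
      have h1 : Continuous fun t => ⟪W.opReal t φ, B (W.opReal t ψ)⟫_ℂ :=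
        (W.continuous_opReal φ).inner (B.continuous.comp (W.continuous_opReal ψ))
      have h2 : Continuous (Function.uncurry fun t s : ℝ =>
          L.Φ.val (K s) (W.opReal (t - s) φ) (W.opReal (t - s) ψ)) :=
        (hcont.continuous_val hK hφ hψ).comp
          (continuous_snd.prodMk (continuous_fst.sub continuous_snd))
      exact h1.add
        (intervalIntegral.continuous_parametric_intervalIntegral_of_continuous h2 continuous_id)
    exact (hjoint.comp (continuous_id.max continuous_const)).congr fun t =>
      (hK'b t ⟨φ, hφ⟩ ⟨ψ, hψ⟩).symm
  · intro t ht φ hφ ψ hψ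
    have := hK'b t ⟨φ, hφ⟩ ⟨ψ, hψ⟩
    rw [max_eq_left ht] at this
    exact this

theorem isWeaklyContinuousBounded_conj (W : ContractionSemigroup H) (B : H →L[ℂ] H) :
    IsWeaklyContinuousBounded (fun t => star (W.opReal t) * B * W.opReal t) ‖B‖ := by
  constructor
  · intro t
    have h := W.norm_opReal_le t
    calc ‖star (W.opReal t) * B * W.opReal t‖ ≤ ‖star (W.opReal t)‖ * ‖B‖ * ‖W.opReal t‖ :=
          (norm_mul_le _ _).trans (by gcongr; exact norm_mul_le _ _)
      _ ≤ 1 * ‖B‖ * 1 := by rw [norm_star]; gcongr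
      _ = ‖B‖ := by ring
  · intro φ ψ
    have h1 : Continuous fun t => ⟪W.opReal t φ, B (W.opReal t ψ)⟫_ℂ :=
      (W.continuous_opReal φ).inner (B.continuous.comp (W.continuous_opReal ψ))
    exact h1.congr fun t => (ContinuousLinearMap.adjoint_inner_right (W.opReal t) φ _).symm

/-- The iteration of the integral master equation is well defined. -/
theorem exists_isIteration (hdom : L.DomainAssumptions W N) (hW : W.IsGeneratedBy L.G)
    (hcont : L.ContinuityConditions W N) :
    ∃ P : ℕ → ℝ → (H →L[ℂ] H) → (H →L[ℂ] H), L.IsIteration W N P := by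
  -- The step is meaningful only on weakly continuous families bounded by `‖B‖`, a class which `hQ`
  -- shows to be preserved.
  choose! next hnext hnext' using fun (B : H →L[ℂ] H) (K : ℝ → H →L[ℂ] H)
    (hK : IsWeaklyContinuousBounded K ‖B‖) => exists_iteration_step hdom hW hcont B hK
  let Q : (H →L[ℂ] H) → ℕ → ℝ → H →L[ℂ] H := fun B n =>
    Nat.rec (fun t => star (W.opReal t) * B * W.opReal t) (fun _ K => next B K) n
  have hQ : ∀ B n, IsWeaklyContinuousBounded (Q B n) ‖B‖ := by
    intro B n
    induction n with
    | zero => exact isWeaklyContinuousBounded_conj W B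
    | succ n ih => exact hnext B _ ih
  refine ⟨fun n t B => Q B n t, fun t ht B => ?_, fun n t ht B ψ hψ => ?_⟩
  · change star (W.opReal t) * B * W.opReal t = _
    rw [W.opReal_of_nonneg ht]
  · have heq : ∀ s ∈ uIcc 0 t, L.Φ.val (Q B n s) (W.opReal (t - s) ψ) (W.opReal (t - s) ψ)
        = L.Φ.val (Q B n s) (W.op (t - s) ψ) (W.op (t - s) ψ) := by
      intro s hs
      rw [uIcc_of_le ht] at hs
      rw [W.opReal_of_nonneg (sub_nonneg.2 hs.2)]
    refine ⟨((hcont.continuous_val_sub (hQ B n) hψ hψ t).intervalIntegrable _ _).congr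
      fun s hs => heq s (uIoc_subset_uIcc hs), ?_⟩
    rw [← intervalIntegral.integral_congr heq, ← W.opReal_of_nonneg ht]
    exact hnext' B (Q B n) (hQ B n) t ht ψ hψ ψ hψ

end FormalGenerator

end MarkovMaster

/-! ### Order properties of the iterates and existence of the minimal semigroup. -/

namespace MarkovMaster

/-- Monotonicity of the interval integral for the order of the complex numbers. -/
theorem intervalIntegral_mono_complex {f g : ℝ → ℂ} {a b : ℝ} (hab : a ≤ b)
    (hf : IntervalIntegrable f volume a b) (hg : IntervalIntegrable g volume a b)
    (h : ∀ s ∈ Icc a b, f s ≤ g s) : ∫ s in a..b, f s ≤ ∫ s in a..b, g s := by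
  have hre : ∀ {u : ℝ → ℂ}, IntervalIntegrable u volume a b →
      (∫ s in a..b, u s).re = ∫ s in a..b, (u s).re := fun hu =>
    (Complex.reCLM.intervalIntegral_comp_comm hu).symm
  have him : ∀ {u : ℝ → ℂ}, IntervalIntegrable u volume a b →
      (∫ s in a..b, u s).im = ∫ s in a..b, (u s).im := fun hu =>
    (Complex.imCLM.intervalIntegral_comp_comm hu).symm
  rw [Complex.le_def, hre hf, hre hg, him hf, him hg]
  constructor
  · exact intervalIntegral.integral_mono_on hab ⟨hf.1.re, hf.2.re⟩ ⟨hg.1.re, hg.2.re⟩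
      fun s hs => (Complex.le_def.1 (h s hs)).1
  · refine intervalIntegral.integral_congr fun s hs => ?_
    rw [uIcc_of_le hab] at hs
    exact (Complex.le_def.1 (h s hs)).2

variable {H : Type*} [NormedAddCommGroup H] [InnerProductSpace ℂ H] [CompleteSpace H]

theorem inner_star_mul_mul (V B : H →L[ℂ] H) (φ ψ : H) :
    ⟪φ, (star V * B * V) ψ⟫_ℂ = ⟪V φ, B (V ψ)⟫_ℂ :=
  ContinuousLinearMap.adjoint_inner_right V φ _

namespace FormalGenerator

variable {L : FormalGenerator H} {W : ContractionSemigroup H} {N : ℕ}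

theorem DomainAssumptions.integral_val_one_op (hdom : L.DomainAssumptions W N)
    (hW : W.IsGeneratedBy L.G) (hcont : L.ContinuityConditions W N) {ψ : H}
    (hψ : ψ ∈ powDomain L.G N) {t : ℝ} (ht : 0 ≤ t) :
    IntervalIntegrable (fun s => L.Φ.val 1 (W.op (t - s) ψ) (W.op (t - s) ψ)) volume 0 t ∧
    ∫ s in (0 : ℝ)..t, L.Φ.val 1 (W.op (t - s) ψ) (W.op (t - s) ψ)
      = ⟪ψ, ψ⟫_ℂ - ⟪W.op t ψ, W.op t ψ⟫_ℂ := by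
  have heq : ∀ s ∈ uIcc 0 t, L.Φ.val 1 (W.opReal (t - s) ψ) (W.opReal (t - s) ψ)
      = L.Φ.val 1 (W.op (t - s) ψ) (W.op (t - s) ψ) := by
    intro s hs
    rw [uIcc_of_le ht] at hs
    rw [W.opReal_of_nonneg (sub_nonneg.2 hs.2)]
  refine ⟨((hcont.continuous_val_sub (isWeaklyContinuousBounded_const 1) hψ hψ
    t).intervalIntegrable _ _).congr fun s hs => heq s (uIoc_subset_uIcc hs), ?_⟩
  rw [← intervalIntegral.integral_congr heq, hdom.integral_val_one hW hcont hψ ht,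
    W.opReal_of_nonneg ht]

namespace IsIteration

variable {P : ℕ → ℝ → (H →L[ℂ] H) → (H →L[ℂ] H)}

theorem inner_zero (hP : L.IsIteration W N P) {t : ℝ} (ht : 0 ≤ t) (B : H →L[ℂ] H) (φ ψ : H) :
    ⟪φ, P 0 t B ψ⟫_ℂ = ⟪W.op t φ, B (W.op t ψ)⟫_ℂ := by
  rw [hP.1 t ht, inner_star_mul_mul]

/-- An arbitrary family satisfying `IsIteration` is known only through quadratic forms on `D_N`, but
by density these determine the operators. -/
theorem map_add (hP : L.IsIteration W N P) (hD : Dense (powDomain L.G N : Set H)) (n : ℕ) :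
    ∀ {t : ℝ}, 0 ≤ t → ∀ B C, P n t (B + C) = P n t B + P n t C := by
  induction n with
  | zero =>
    intro t ht B C
    rw [hP.1 t ht, hP.1 t ht, hP.1 t ht]
    noncomm_ring
  | succ n ih =>
    intro t ht B C
    refine eq_of_dense hD fun ψ hψ => ?_
    have heq : ∀ s ∈ uIcc 0 t, L.Φ.val (P n s (B + C)) (W.op (t - s) ψ) (W.op (t - s) ψ)
        = L.Φ.val (P n s B) (W.op (t - s) ψ) (W.op (t - s) ψ)
          + L.Φ.val (P n s C) (W.op (t - s) ψ) (W.op (t - s) ψ) := by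
      intro s hs
      rw [uIcc_of_le ht] at hs
      rw [ih hs.1, CPFormMap.val_add_op]
    rw [add_apply, inner_add_right, (hP.2 n t ht B ψ hψ).2,
      (hP.2 n t ht C ψ hψ).2, (hP.2 n t ht (B + C) ψ hψ).2, intervalIntegral.integral_congr heq,
      intervalIntegral.integral_add (hP.2 n t ht B ψ hψ).1 (hP.2 n t ht C ψ hψ).1,
      add_apply, inner_add_right]
    ring

theorem map_smul (hP : L.IsIteration W N P) (hD : Dense (powDomain L.G N : Set H)) (n : ℕ) :
    ∀ {t : ℝ}, 0 ≤ t → ∀ (c : ℂ) B, P n t (c • B) = c • P n t B := by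
  induction n with
  | zero =>
    intro t ht c B
    rw [hP.1 t ht, hP.1 t ht, mul_smul_comm, smul_mul_assoc]
  | succ n ih =>
    intro t ht c B
    refine eq_of_dense hD fun ψ hψ => ?_
    have heq : ∀ s ∈ uIcc 0 t, L.Φ.val (P n s (c • B)) (W.op (t - s) ψ) (W.op (t - s) ψ)
        = c * L.Φ.val (P n s B) (W.op (t - s) ψ) (W.op (t - s) ψ) := by
      intro s hs
      rw [uIcc_of_le ht] at hs
      rw [ih hs.1, CPFormMap.val_smul_op]
    rw [smul_apply, inner_smul_right, (hP.2 n t ht B ψ hψ).2,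
      (hP.2 n t ht (c • B) ψ hψ).2, intervalIntegral.integral_congr heq,
      intervalIntegral.integral_const_mul, smul_apply, inner_smul_right]
    ring

theorem map_sub (hP : L.IsIteration W N P) (hD : Dense (powDomain L.G N : Set H)) (n : ℕ)
    {t : ℝ} (ht : 0 ≤ t) (B C : H →L[ℂ] H) : P n t (B - C) = P n t B - P n t C := by
  have h := hP.map_add hD n ht (B - C) C
  rw [sub_add_cancel] at h
  rw [h, add_sub_cancel_right]

theorem nonneg (hP : L.IsIteration W N P) (hD : Dense (powDomain L.G N : Set H)) (n : ℕ)
    {B : H →L[ℂ] H} (hB : 0 ≤ B) : ∀ {t : ℝ}, 0 ≤ t → 0 ≤ P n t B := by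
  induction n with
  | zero =>
    intro t ht
    rw [hP.1 t ht]
    exact star_left_conjugate_nonneg hB _
  | succ n ih =>
    intro t ht
    refine nonneg_of_dense hD fun ψ hψ => ?_
    obtain ⟨hi, h⟩ := hP.2 n t ht B ψ hψ
    rw [h]
    refine add_nonneg (nonneg_iff_inner.1 hB _) ?_
    have := intervalIntegral_mono_complex ht (f := fun _ => 0) (by simp) hi
      fun s hs => CPFormMap.val_nonneg (ih hs.1) _
    simpa using this

/-- The first step adds a nonnegative integral; positivity of `Φ` propagates the inequality. -/
theorem le_succ (hP : L.IsIteration W N P) (hD : Dense (powDomain L.G N : Set H)) (n : ℕ)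
    {B : H →L[ℂ] H} (hB : 0 ≤ B) : ∀ {t : ℝ}, 0 ≤ t → P n t B ≤ P (n + 1) t B := by
  induction n with
  | zero =>
    intro t ht
    refine le_of_dense hD fun ψ hψ => ?_
    obtain ⟨hi, h⟩ := hP.2 0 t ht B ψ hψ
    rw [h, hP.inner_zero ht]
    refine le_add_of_nonneg_right ?_
    have := intervalIntegral_mono_complex ht (f := fun _ => 0) (by simp) hi
      fun s hs => CPFormMap.val_nonneg (hP.nonneg hD 0 hB hs.1) _
    simpa using this
  | succ n ih =>
    intro t ht
    refine le_of_dense hD fun ψ hψ => ?_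
    obtain ⟨hi, h⟩ := hP.2 n t ht B ψ hψ
    obtain ⟨hi', h'⟩ := hP.2 (n + 1) t ht B ψ hψ
    rw [h, h']
    gcongr
    exact intervalIntegral_mono_complex ht hi hi' fun s hs => CPFormMap.val_mono (ih hs.1) _

theorem monotone (hP : L.IsIteration W N P) (hD : Dense (powDomain L.G N : Set H))
    {B : H →L[ℂ] H} (hB : 0 ≤ B) {t : ℝ} (ht : 0 ≤ t) : Monotone fun n => P n t B :=
  monotone_nat_of_le_succ fun n => hP.le_succ hD n hB ht

/-- By the energy balance the unit solves the integral equation exactly, so it dominates every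
iterate started from it. -/
theorem map_one_le (hP : L.IsIteration W N P) (hdom : L.DomainAssumptions W N)
    (hW : W.IsGeneratedBy L.G) (hcont : L.ContinuityConditions W N) (n : ℕ) :
    ∀ {t : ℝ}, 0 ≤ t → P n t 1 ≤ 1 := by
  have hD := hdom.dense hW
  suffices h : ∀ m, ∀ {t : ℝ}, 0 ≤ t → P (m + 1) t 1 ≤ 1 from fun {t} ht =>
    (hP.le_succ hD n zero_le_one ht).trans (h n ht)
  have hstep : ∀ m, (∀ {t : ℝ}, 0 ≤ t → P m t 1 ≤ 1) → ∀ {t : ℝ}, 0 ≤ t → P (m + 1) t 1 ≤ 1 := by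
    intro m ih t ht
    refine le_of_dense hD fun ψ hψ => ?_
    obtain ⟨hi, h⟩ := hP.2 m t ht 1 ψ hψ
    obtain ⟨hi', h'⟩ := hdom.integral_val_one_op hW hcont hψ ht
    have hle := intervalIntegral_mono_complex ht hi hi' fun s hs => CPFormMap.val_mono (ih hs.1) _
    rw [h', le_sub_iff_add_le'] at hle
    rw [h]
    exact hle
  intro m
  induction m with
  | zero =>
    refine hstep 0 fun {t} ht => le_of_dense hD fun ψ hψ => ?_
    obtain ⟨hi', h'⟩ := hdom.integral_val_one_op hW hcont hψ ht
    have := intervalIntegral_mono_complex ht (f := fun _ => 0) (by simp) hi'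
      fun s hs => CPFormMap.val_nonneg zero_le_one _
    rw [h', intervalIntegral.integral_zero, sub_nonneg] at this
    rw [hP.inner_zero ht]
    exact this
  | succ m ih => exact hstep _ ih

/-- Positivity and linearity carry `B ≤ ‖B‖·1` to the iterates, where `map_one_le` applies. -/
theorem norm_le (hP : L.IsIteration W N P) (hdom : L.DomainAssumptions W N)
    (hW : W.IsGeneratedBy L.G) (hcont : L.ContinuityConditions W N) (n : ℕ)
    {B : H →L[ℂ] H} (hB : 0 ≤ B) {t : ℝ} (ht : 0 ≤ t) : ‖P n t B‖ ≤ ‖B‖ := by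
  have hD := hdom.dense hW
  have h1 : P n t B ≤ (‖B‖ : ℂ) • (1 : H →L[ℂ] H) := by
    have h2 := hP.nonneg hD n (sub_nonneg.2 (le_norm_smul_one hB)) ht
    rw [hP.map_sub hD n ht, sub_nonneg, hP.map_smul hD n ht] at h2
    exact h2.trans (smul_le_smul_of_nonneg_left (hP.map_one_le hdom hW hcont n ht) (by simp))
  refine (CStarAlgebra.norm_le_norm_of_nonneg_of_le (hP.nonneg hD n hB ht) h1).trans ?_
  rw [norm_smul, Complex.norm_real, norm_norm]
  exact mul_le_of_le_one_right (norm_nonneg _) ContinuousLinearMap.norm_id_le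

/-- The iterates converge weakly at every bounded operator. -/
theorem exists_limit (hP : L.IsIteration W N P) (hdom : L.DomainAssumptions W N)
    (hW : W.IsGeneratedBy L.G) (hcont : L.ContinuityConditions W N) {t : ℝ} (ht : 0 ≤ t)
    (B : H →L[ℂ] H) : ∃ T : H →L[ℂ] H,
      ∀ φ ψ, Tendsto (fun n => ⟪φ, P n t B ψ⟫_ℂ) atTop (𝓝 ⟪φ, T ψ⟫_ℂ) := by
  have hD := hdom.dense hW
  -- Positive operators span, so monotone convergence extends to every `B` by linearity.
  have hB : B ∈ Submodule.span ℂ {a : H →L[ℂ] H | 0 ≤ a} := by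
    rw [CStarAlgebra.span_nonneg]
    trivial
  induction hB using Submodule.span_induction with
  | mem B hB =>
    obtain ⟨T, -, hT⟩ := exists_weak_limit_of_monotone
      (fun n => hP.norm_le hdom hW hcont n hB ht) (hP.monotone hD hB ht)
    exact ⟨T, hT⟩
  | zero =>
    refine ⟨0, fun φ ψ => tendsto_const_nhds.congr fun n => ?_⟩
    have := hP.map_smul hD n ht 0 0
    rw [zero_smul, zero_smul] at this
    rw [this]
  | add B C _ _ hB hC =>
    obtain ⟨T, hT⟩ := hB
    obtain ⟨S, hS⟩ := hC
    refine ⟨T + S, fun φ ψ => ?_⟩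
    simp only [hP.map_add hD _ ht, add_apply, inner_add_right]
    exact (hT φ ψ).add (hS φ ψ)
  | smul c B _ hB =>
    obtain ⟨T, hT⟩ := hB
    refine ⟨c • T, fun φ ψ => ?_⟩
    simp only [hP.map_smul hD _ ht, smul_apply, inner_smul_right]
    exact (hT φ ψ).const_mul c

end IsIteration

/-- The minimal quantum dynamical semigroup exists. -/
theorem exists_isMinimalQDS (hdom : L.DomainAssumptions W N) (hW : W.IsGeneratedBy L.G)
    (hcont : L.ContinuityConditions W N) :
    ∃ T : ℝ → (H →L[ℂ] H) →ₗ[ℂ] (H →L[ℂ] H), L.IsMinimalQDS W N T := by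
  obtain ⟨P, hP⟩ := exists_isIteration hdom hW hcont
  have hD := hdom.dense hW
  choose! T hT using fun (t : ℝ) (ht : 0 ≤ t) (B : H →L[ℂ] H) =>
    hP.exists_limit hdom hW hcont ht B
  have hlin : ∀ t, 0 ≤ t → ∃ S : (H →L[ℂ] H) →ₗ[ℂ] (H →L[ℂ] H), ∀ B, S B = T t B := by
    intro t ht
    refine ⟨{ toFun := T t, map_add' := fun B C => ?_, map_smul' := fun c B => ?_ }, fun _ => rfl⟩
    · refine ContinuousLinearMap.ext fun ψ => ext_inner_left ℂ fun φ =>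
        tendsto_nhds_unique (hT t ht _ φ ψ) ?_
      simp only [hP.map_add hD _ ht, add_apply, inner_add_right]
      exact (hT t ht B φ ψ).add (hT t ht C φ ψ)
    · refine ContinuousLinearMap.ext fun ψ => ext_inner_left ℂ fun φ =>
        tendsto_nhds_unique (hT t ht _ φ ψ) ?_
      simp only [hP.map_smul hD _ ht, RingHom.id_apply, smul_apply, inner_smul_right]
      exact (hT t ht B φ ψ).const_mul c
  choose! S hS using hlin
  refine ⟨S, P, hP, fun t ht B hB => ?_⟩
  rw [hS t ht]
  exact isLUB_of_weak_limit (hP.monotone hD hB ht) (hT t ht B)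

end FormalGenerator

end MarkovMaster

/-! ### Comparison of the growing subsolution with the defect of the unit. -/

namespace MarkovMaster

variable {H : Type*} [NormedAddCommGroup H] [InnerProductSpace ℂ H] [CompleteSpace H]

/-- The hypothesis on `X` is used only through real parts; self-adjointness supplies the rest. -/
theorem nonneg_of_dense_re {D : Submodule ℂ H} (hD : Dense (D : Set H)) {A : H →L[ℂ] H}
    (hA : IsSelfAdjoint A) (h : ∀ ψ ∈ D, 0 ≤ (⟪ψ, A ψ⟫_ℂ).re) : 0 ≤ A := by
  rw [ContinuousLinearMap.nonneg_iff_isPositive, ContinuousLinearMap.isPositive_def']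
  refine ⟨hA, fun ψ => ?_⟩
  have h1 : 0 ≤ (⟪ψ, A ψ⟫_ℂ).re :=
    hD.induction (P := fun ψ : H => 0 ≤ (⟪ψ, A ψ⟫_ℂ).re) h
      (isClosed_le continuous_const (Complex.continuous_re.comp (by fun_prop))) ψ
  rw [ContinuousLinearMap.reApplyInnerSelf_apply, ← inner_conj_symm, RCLike.conj_re]
  exact h1

namespace FormalGenerator

variable {L : FormalGenerator H} {W : ContractionSemigroup H} {N : ℕ}

/-- A superharmonic operator gives an exponentially growing subsolution of the integral master
equation. -/
theorem exp_mul_inner_le (hdom : L.DomainAssumptions W N) (hW : W.IsGeneratedBy L.G)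
    (hcont : L.ContinuityConditions W N) {X : H →L[ℂ] H} {ε : ℝ}
    (hL : ∀ ψ : L.G.domain, (ψ : H) ∈ powDomain L.G N →
      ε * (⟪(ψ : H), X ψ⟫_ℂ).re ≤ (L.quadForm X ψ).re)
    {ψ : H} (hψ : ψ ∈ powDomain L.G N) {t : ℝ} (ht : 0 ≤ t) :
    IntervalIntegrable (fun s => L.Φ.val ((Real.exp (ε * s) : ℂ) • X)
      (W.op (t - s) ψ) (W.op (t - s) ψ)) volume 0 t ∧
    Real.exp (ε * t) * (⟪ψ, X ψ⟫_ℂ).re ≤ (⟪W.op t ψ, X (W.op t ψ)⟫_ℂ).re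
      + ∫ s in (0 : ℝ)..t, (L.Φ.val ((Real.exp (ε * s) : ℂ) • X)
        (W.op (t - s) ψ) (W.op (t - s) ψ)).re := by
  have hvc : Continuous fun s => L.Φ.val X (W.opReal s ψ) (W.opReal s ψ) :=
    (hcont.continuous_val (isWeaklyContinuousBounded_const X) hψ hψ).comp
      (continuous_const.prodMk continuous_id : Continuous fun s : ℝ => ((0 : ℝ), s))
  have hval : ∀ s ∈ uIcc 0 t,
      (Real.exp (ε * s) : ℂ) * L.Φ.val X (W.opReal (t - s) ψ) (W.opReal (t - s) ψ)
        = L.Φ.val ((Real.exp (ε * s) : ℂ) • X) (W.op (t - s) ψ) (W.op (t - s) ψ) := by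
    intro s hs
    rw [uIcc_of_le ht] at hs
    rw [W.opReal_of_nonneg (sub_nonneg.2 hs.2), CPFormMap.val_smul_op]
  constructor
  · have hc : Continuous fun s : ℝ =>
        (Real.exp (ε * s) : ℂ) * L.Φ.val X (W.opReal (t - s) ψ) (W.opReal (t - s) ψ) :=
      (Complex.continuous_ofReal.comp (by fun_prop)).mul
        (hvc.comp (continuous_const.sub continuous_id))
    exact (hc.intervalIntegrable _ _).congr fun s hs => hval s (uIoc_subset_uIcc hs)
  -- The reflection `s ↦ t - s` moves the time lag from the orbit to the exponential.
  have hint : ∫ s in (0 : ℝ)..t, (L.Φ.val ((Real.exp (ε * s) : ℂ) • X)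
        (W.op (t - s) ψ) (W.op (t - s) ψ)).re
      = ∫ s in (0 : ℝ)..t, Real.exp (ε * (t - s)) *
        (L.Φ.val X (W.opReal s ψ) (W.opReal s ψ)).re := by
    have h1 : ∀ s ∈ uIcc 0 t, (L.Φ.val ((Real.exp (ε * s) : ℂ) • X)
        (W.op (t - s) ψ) (W.op (t - s) ψ)).re = (fun r => Real.exp (ε * (t - r)) *
          (L.Φ.val X (W.opReal r ψ) (W.opReal r ψ)).re) (t - s) := by
      intro s hs
      simp only [← hval s hs, Complex.re_ofReal_mul, sub_sub_cancel]
    rw [intervalIntegral.integral_congr h1, intervalIntegral.integral_comp_sub_left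
      (fun r => Real.exp (ε * (t - r)) * (L.Φ.val X (W.opReal r ψ) (W.opReal r ψ)).re), sub_self,
      sub_zero]
  have hdm := hdom.hasCore.le_domain hψ
  set η := L.G ⟨ψ, hdm⟩
  have hgr : (ψ, η) ∈ L.G.graph := L.G.mem_graph ⟨ψ, hdm⟩
  set q : ℝ → ℂ := fun s => ⟪W.opReal s ψ, X (W.opReal s ψ)⟫_ℂ
  set d : ℝ → ℂ := fun s =>
    ⟪W.opReal s η, X (W.opReal s ψ)⟫_ℂ + ⟪W.opReal s ψ, X (W.opReal s η)⟫_ℂ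
  have hUψ := W.continuous_opReal ψ
  have hUη := W.continuous_opReal η
  have hqc : Continuous q := hUψ.inner (X.continuous.comp hUψ)
  have hdc : Continuous d :=
    (hUη.inner (X.continuous.comp hUψ)).add (hUψ.inner (X.continuous.comp hUη))
  have hqd : ∀ s, 0 ≤ s → ε * (q s).re + (d s).re
      ≤ (L.Φ.val X (W.opReal s ψ) (W.opReal s ψ)).re := by
    intro s hs
    have h1 := hW.op_mem_graph hgr hs
    rw [← W.opReal_of_nonneg hs] at h1
    obtain ⟨u, hu, hu'⟩ := (L.G.mem_graph_iff).1 h1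
    simp only at hu hu'
    have hm := hdom.opReal_mem s hψ
    rw [← hu] at hm
    have h2 := hL u hm
    rw [quadForm, hu', hu, Complex.sub_re, Complex.sub_re] at h2
    simp only [q, d, Complex.add_re]
    linarith
  have hexp : Continuous fun s => Real.exp (ε * (t - s)) := by fun_prop
  have hftc := intervalIntegral.integral_eq_sub_of_hasDeriv_right (a := 0) (b := t)
    (f := fun s => -(Real.exp (ε * (t - s)) * (q s).re))
    (f' := fun s => Real.exp (ε * (t - s)) * (ε * (q s).re + (d s).re))
    (hexp.mul (Complex.continuous_re.comp hqc)).neg.continuousOn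
    (fun s hs => by
      have hs0 : 0 ≤ s := by
        have := hs.1
        rw [min_eq_left ht] at this
        exact this.le
      have hd := hW.hasDerivWithinAt_opReal hgr hs0
      have hXd : HasDerivWithinAt (fun r => X (W.opReal r ψ)) (X (-W.opReal s η)) (Ioi s) s :=
        (X.restrictScalars ℝ).hasFDerivAt.comp_hasDerivWithinAt s hd
      have hq : HasDerivWithinAt (fun r => (q r).re) (-(d s)).re (Ioi s) s := by
        have hqc : HasDerivWithinAt q (-(d s)) (Ioi s) s := (hd.inner ℂ hXd).congr_deriv ?_
        · exact Complex.reCLM.hasFDerivAt.comp_hasDerivWithinAt s hqc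
        simp only [d, _root_.map_neg, inner_neg_left, inner_neg_right]
        ring
      have he : HasDerivWithinAt (fun r => Real.exp (ε * (t - r)))
          (Real.exp (ε * (t - s)) * (ε * (-1))) (Ioi s) s :=
        ((((hasDerivAt_id s).const_sub t).const_mul ε).exp).hasDerivWithinAt
      refine (he.mul hq).neg.congr_deriv ?_
      rw [Complex.neg_re]
      ring)
    ((hexp.mul ((continuous_const.mul (Complex.continuous_re.comp hqc)).add
      (Complex.continuous_re.comp hdc))).intervalIntegrable _ _)
  have hmono : ∫ s in (0 : ℝ)..t, Real.exp (ε * (t - s)) * (ε * (q s).re + (d s).re)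
      ≤ ∫ s in (0 : ℝ)..t, Real.exp (ε * (t - s)) *
        (L.Φ.val X (W.opReal s ψ) (W.opReal s ψ)).re := by
    refine intervalIntegral.integral_mono_on ht
      ((hexp.mul ((continuous_const.mul (Complex.continuous_re.comp hqc)).add
      (Complex.continuous_re.comp hdc))).intervalIntegrable _ _)
      ((hexp.mul (Complex.continuous_re.comp hvc)).intervalIntegrable _ _) fun s hs => ?_
    gcongr
    exact hqd s hs.1
  rw [hftc] at hmono
  rw [hint]
  have hq0 : q 0 = ⟪ψ, X ψ⟫_ℂ := by
    simp only [q]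
    rw [W.opReal_of_nonneg le_rfl, W.op_zero, one_apply_eq_self]
  have hqt : q t = ⟪W.op t ψ, X (W.op t ψ)⟫_ℂ := by
    simp only [q]
    rw [W.opReal_of_nonneg ht]
  rw [hq0, hqt, sub_self, mul_zero, Real.exp_zero, sub_zero] at hmono
  linarith

/-- The comparison of the exponentially growing subsolution with the defect of the unit. -/
theorem IsIteration.exp_smul_sub_le {P : ℕ → ℝ → (H →L[ℂ] H) → (H →L[ℂ] H)}
    (hP : L.IsIteration W N P) (hdom : L.DomainAssumptions W N) (hW : W.IsGeneratedBy L.G)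
    (hcont : L.ContinuityConditions W N) {X : H →L[ℂ] H} (hX : 0 ≤ X) (hX1 : ‖X‖ ≤ 1) {ε : ℝ}
    (hε : 0 ≤ ε)
    (hL : ∀ ψ : L.G.domain, (ψ : H) ∈ powDomain L.G N →
      ε * (⟪(ψ : H), X ψ⟫_ℂ).re ≤ (L.quadForm X ψ).re) (T : ℝ) (n : ℕ) :
    ∀ t, 0 ≤ t → t ≤ T → (Real.exp (ε * t) : ℂ) • X - P n t X
      ≤ (Real.exp (ε * T) : ℂ) • (1 - P n t 1) := by
  have hD := hdom.dense hW
  set c := Real.exp (ε * T)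
  have hexp : ∀ s : ℝ, (0 : ℂ) ≤ (Real.exp (ε * s) : ℂ) := fun s =>
    Complex.zero_le_real.2 (Real.exp_pos _).le
  have hstep : ∀ (Q R : ℝ → H →L[ℂ] H) (t : ℝ), 0 ≤ t →
      (∀ s, 0 ≤ s → s ≤ t → (Real.exp (ε * s) : ℂ) • X - Q s ≤ (c : ℂ) • (1 - R s)) →
      ∀ ψ ∈ powDomain L.G N,
      IntervalIntegrable (fun s => L.Φ.val (Q s) (W.op (t - s) ψ) (W.op (t - s) ψ)) volume 0 t →
      IntervalIntegrable (fun s => L.Φ.val (R s) (W.op (t - s) ψ) (W.op (t - s) ψ)) volume 0 t →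
      Real.exp (ε * t) * (⟪ψ, X ψ⟫_ℂ).re - (⟪W.op t ψ, X (W.op t ψ)⟫_ℂ
        + ∫ s in (0 : ℝ)..t, L.Φ.val (Q s) (W.op (t - s) ψ) (W.op (t - s) ψ)).re
      ≤ c * ((⟪ψ, ψ⟫_ℂ).re - (⟪W.op t ψ, W.op t ψ⟫_ℂ
        + ∫ s in (0 : ℝ)..t, L.Φ.val (R s) (W.op (t - s) ψ) (W.op (t - s) ψ)).re) := by
    intro Q R t ht hQR ψ hψ hQ hR
    obtain ⟨hi, hle⟩ := exp_mul_inner_le hdom hW hcont hL hψ ht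
    obtain ⟨hi1, h1⟩ := hdom.integral_val_one_op hW hcont hψ ht
    have hcomp := (Complex.le_def.1 (intervalIntegral_mono_complex ht (hi.sub hQ)
      ((hi1.sub hR).const_mul (c : ℂ)) fun s hs => by
        have := CPFormMap.val_mono (Φ := L.Φ) (hQR s hs.1 hs.2) (W.op (t - s) ψ)
        rwa [CPFormMap.val_sub_op, CPFormMap.val_smul_op _ (c : ℂ), CPFormMap.val_sub_op] at this)).1
    rw [intervalIntegral.integral_sub hi hQ, intervalIntegral.integral_const_mul,
      intervalIntegral.integral_sub hi1 hR, h1, Complex.sub_re, Complex.re_ofReal_mul,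
      Complex.sub_re, Complex.sub_re] at hcomp
    have hre := Complex.reCLM.intervalIntegral_comp_comm hi
    simp only [Complex.reCLM_apply] at hre
    rw [hre] at hle
    rw [Complex.add_re, Complex.add_re]
    linarith
  have hop : ∀ (m : ℕ) (t : ℝ), 0 ≤ t → (∀ ψ ∈ powDomain L.G N,
      Real.exp (ε * t) * (⟪ψ, X ψ⟫_ℂ).re - (⟪ψ, P m t X ψ⟫_ℂ).re
        ≤ c * ((⟪ψ, ψ⟫_ℂ).re - (⟪ψ, P m t 1 ψ⟫_ℂ).re)) →
      (Real.exp (ε * t) : ℂ) • X - P m t X ≤ (c : ℂ) • (1 - P m t 1) := by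
    intro m t ht h
    have hc : (0 : ℂ) ≤ c := hexp T
    have hs1 := smul_nonneg hc (sub_nonneg.2 (hP.map_one_le hdom hW hcont m ht))
    rw [← sub_nonneg]
    refine nonneg_of_dense_re hD ?_ fun ψ hψ => ?_
    · exact (IsSelfAdjoint.of_nonneg hs1).sub ((IsSelfAdjoint.of_nonneg
        (smul_nonneg (hexp t) hX)).sub (IsSelfAdjoint.of_nonneg (hP.nonneg hD m hX ht)))
    · have := h ψ hψ
      simp only [sub_apply, smul_apply, one_apply_eq_self, inner_sub_right, inner_smul_right,
        Complex.sub_re, Complex.re_ofReal_mul]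
      linarith
  induction n with
  | zero =>
    intro t ht htT
    refine hop 0 t ht fun ψ hψ => ?_
    have hval0 : ∀ φ : H, L.Φ.val 0 φ φ = 0 := fun φ => by
      simpa using L.Φ.val_smul_op 0 0 φ φ
    have h := hstep (fun _ => 0) (fun _ => 0) t ht (fun s _ hs => by
      rw [sub_zero, sub_zero]
      have h1 : X ≤ 1 := by
        refine (le_norm_smul_one hX).trans ?_
        have := smul_le_smul_of_nonneg_right (Complex.real_le_real.2 hX1)
          (zero_le_one (α := H →L[ℂ] H))
        simpa using this
      refine (smul_le_smul_of_nonneg_left h1 (hexp s)).trans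
        (smul_le_smul_of_nonneg_right (Complex.real_le_real.2 ?_) zero_le_one)
      exact Real.exp_le_exp.2 (mul_le_mul_of_nonneg_left (hs.trans htT) hε)) ψ hψ
      (by simp [hval0]) (by simp [hval0])
    simp only [hval0, intervalIntegral.integral_zero, add_zero] at h
    rw [hP.inner_zero ht, hP.inner_zero ht]
    exact h
  | succ n ih =>
    intro t ht htT
    refine hop (n + 1) t ht fun ψ hψ => ?_
    obtain ⟨hiX, hX'⟩ := hP.2 n t ht X ψ hψ
    obtain ⟨hi1, h1'⟩ := hP.2 n t ht 1 ψ hψ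
    rw [hX', h1']
    exact hstep (fun s => P n s X) (fun s => P n s 1) t ht
      (fun s hs hst => ih s hs (hst.trans htT)) ψ hψ hiX hi1

end FormalGenerator

end MarkovMaster

theorem theorem3p1 {H : Type*} [NormedAddCommGroup H] [InnerProductSpace ℂ H] [CompleteSpace H]
    [TopologicalSpace.SeparableSpace H]
    (L : MarkovMaster.FormalGenerator H) (W : MarkovMaster.ContractionSemigroup H)
    (hW : W.IsGeneratedBy L.G) (N : ℕ) (hN : 1 ≤ N)
    (hdom : L.DomainAssumptions W N) (hcont : L.ContinuityConditions W N)
    (X : H →L[ℂ] H) (hX : 0 ≤ X) (hX0 : X ≠ 0) (hX1 : ‖X‖ ≤ 1) (ε : ℝ) (hε : 0 < ε)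
    (hL : ∀ ψ : L.G.domain, (ψ : H) ∈ MarkovMaster.powDomain L.G N →
      ε * (inner ℂ (ψ : H) (X ψ)).re ≤ (L.quadForm X ψ).re) :
    (∃ T : ℝ → (H →L[ℂ] H) →ₗ[ℂ] (H →L[ℂ] H), L.IsMinimalQDS W N T) ∧
      ∀ T : ℝ → (H →L[ℂ] H) →ₗ[ℂ] (H →L[ℂ] H), L.IsMinimalQDS W N T →
        ∃ t : ℝ, 0 < t ∧ T t 1 ≠ 1 := by
  refine ⟨MarkovMaster.FormalGenerator.exists_isMinimalQDS hdom hW hcont, ?_⟩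
  rintro T ⟨P, hP, hT⟩
  by_contra! hone
  have hD := hdom.dense hW
  obtain ⟨ψ, hψ⟩ : ∃ ψ : H, 0 < (inner ℂ ψ (X ψ)).re := by
    by_contra! h
    refine hX0 (MarkovMaster.eq_of_dense (D := ⊤) (by simp) fun ψ _ => ?_)
    have h1 := Complex.nonneg_iff.1 (MarkovMaster.nonneg_iff_inner.1 hX ψ)
    refine Complex.ext ?_ ?_
    · simpa using le_antisymm (h ψ) h1.1
    · simpa using h1.2.symm
  have hgrowth : ∀ t : ℝ, 0 < t → Real.exp (ε * t) * (inner ℂ ψ (X ψ)).re ≤ ‖ψ‖ ^ 2 := by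
    intro t ht
    have hlim := MarkovMaster.tendsto_of_isLUB
      (fun n => hP.norm_le hdom hW hcont n zero_le_one ht.le)
      (hP.monotone hD zero_le_one ht.le) (hT t ht.le 1 zero_le_one) ψ ψ
    rw [hone t ht, one_apply_eq_self] at hlim
    have hre : Tendsto (fun n => ‖ψ‖ ^ 2 + Real.exp (ε * t) *
        ((inner ℂ ψ ψ).re - (inner ℂ ψ (P n t 1 ψ)).re)) atTop (𝓝 (‖ψ‖ ^ 2)) := by
      have := ((((Complex.continuous_re.tendsto _).comp hlim).const_sub
        (inner ℂ ψ ψ).re).const_mul (Real.exp (ε * t))).const_add (‖ψ‖ ^ 2)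
      simpa using this
    refine ge_of_tendsto' hre fun n => ?_
    have h1 := (Complex.le_def.1 (MarkovMaster.le_iff_inner.1
      (hP.exp_smul_sub_le hdom hW hcont hX hX1 hε.le hL t n t ht.le le_rfl) ψ)).1
    simp only [sub_apply, smul_apply, one_apply_eq_self, inner_sub_right, inner_smul_right,
      Complex.sub_re, Complex.re_ofReal_mul] at h1
    have h2 : (inner ℂ ψ (P n t X ψ)).re ≤ ‖ψ‖ ^ 2 := by
      refine (Complex.re_le_norm _).trans ((MarkovMaster.norm_inner_operator_le _ ψ ψ
        ((hP.norm_le hdom hW hcont n hX ht.le).trans hX1)).trans ?_)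
      rw [one_mul, sq]
    linarith
  set a := (inner ℂ ψ (X ψ)).re
  have hpos : 0 < ‖ψ‖ ^ 2 / (ε * a) + 1 := by positivity
  have h1 := hgrowth _ hpos
  have h2 := Real.add_one_le_exp (ε * (‖ψ‖ ^ 2 / (ε * a) + 1))
  have h3 : (ε * (‖ψ‖ ^ 2 / (ε * a) + 1) + 1) * a = ‖ψ‖ ^ 2 + ε * a + a := by
    field_simp
  have h4 := mul_le_mul_of_nonneg_right h2 hψ.le
  have h5 : 0 < ε * a := by positivity
  linarith
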